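/- Let $m,n,s\in\mathbb N$, $f,g,\psi_1,\dots,\psi_s\in\mathbb R[x]=\mathbb R[x_1,\dots,x_m]$, $p\in\mathbb R[x,y]$ with $y=(y_1,\dots,y_n)$, and let $\mathbf Y\subset\mathbb R^n$ be compact. Consider the fractional semi-infinite polynomial program (FSIPP) $$r^\star:=\min_{x\in\mathbf K}\frac{f(x)}{g(x)},\qquad \mathbf K:=\{x\in\mathbb R^m : \psi_j(x)\le 0\ (1\le j\le s),\ p(x,y)\le 0\ \ \forall y\in\mathbf Y\},$$ and assume that its set $\mathbf S$ of minimizers is nonempty. A polynomial $h\in\mathbb R[x]$ is called s.o.s-convex if $\nabla^2h=H^{T}H$ for some $r\in\mathbb N$ and some $r\times m$ matrix $H$ with entries in $\mathbb R[x]$. Let $\Sigma^2[\cdot]$ denote the set of sums of squares of polynomials, $d_y:=\deg_y p$, $\mathbf d:=\max\{\deg f,\deg g,\deg\psi_1,\dots,\deg\psi_s,\deg_xp\}$ and $\mathcal C[x]:=\Sigma^2[x]\cap\mathbb R[x]_{2\mathbf d}$, where $\mathbb R[x]_{k}$ is the set of polynomials of degree at most $k$. Suppose that $f$, $-g$, all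 $\psi_j$, and $p(\cdot,y)$ for every $y\in\mathbf Y$ are s.o.s-convex, and that one of the following two cases holds. Case 1: $n=1$, $\mathbf Y=[-1,1]$; then let $$\mathcal C[y]:=\{\theta_0+\theta_1(1-y_1^2) : \theta_0,\theta_1\in\Sigma^2[y_1],\ \deg\theta_0\le 2\lceil d_y/2\rceil,\ \deg(\theta_1(1-y_1^2))\le 2\lceil d_y/2\rceil\}.$$ Case 2: $n>1$, $\mathbf Y=\{y\in\mathbb R^n:\phi(y)\ge0\}$ with $\deg\phi=2$ and $\phi(\bar y)>0$ for some $\bar y\in\mathbb R^n$, and $d_y=2$; then let $$\mathcal C[y]:=\{\theta+\lambda\phi : \lambda\ge0,\ \theta\in\Sigma^2[y],\ \deg\theta\le2\}.$$ For a set of polynomials $\mathcal C$ let $\mathcal C^*$ be the set of linear functionals on the polynomial ring that are nonnegative on $\mathcal C$. For linear functionals $\mathscr L$ on $\mathbb R[x]$ and $\mathscr H$ on $\mathbb R[y]$, let $\mathscr L(p)\in\mathbb R[y]$ and $\mathscr H(p)\in\mathbb R[x]$ be obtained by applying them to the monomials in $x$, respectively in $y$, of $p$. Define $$r^{\rm primal}:=\sup\Big\{\rho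 : f-\rho g+\mathscr H(p)+\sum_{j=1}^s\eta_j\psi_j\in\mathcal C[x],\ \rho\in\mathbb R,\ \mathscr H\in\mathcal C[y]^*,\ \eta\in\mathbb R_+^s\Big\},$$ $$r^{\rm dual}:=\inf\Big\{\mathscr L(f) : \mathscr L\in\mathcal C[x]^*,\ \mathscr L(g)=1,\ -\mathscr L(p)\in\mathcal C[y],\ \mathscr L(\psi_j)\le0\ (1\le j\le s)\Big\}.$$ Assume (A2): either $f\ge0$ and $g>0$ on $\mathbf K$, or $g$ is affine and $g>0$ on $\mathbf K$. Then: (i) $r^{\rm dual}=r^\star$; the infimum defining $r^{\rm dual}$ is attained; and every minimizer $\mathscr L^\star$ satisfies $\mathscr L^\star(1)>0$ and $$\frac{1}{\mathscr L^\star(1)}\big(\mathscr L^\star(x_1),\dots,\mathscr L^\star(x_m)\big)\in\mathbf S.$$ (ii) Suppose in addition that (A3) holds: there are a finite nonnegative Borel measure $\mu^\star$ supported on $\mathbf Y$ and $\eta^\star\in\mathbb R_+^s$ with $$\inf_{x\in\mathbb R^m}\Big(f(x)-r^\star g(x)+\int_{\mathbf Y}p(x,y)\,d\mu^\star(y)+\sum_{j=1}^s\eta^\star_j\psi_j(x)\Big)=0.$$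 Then $r^{\rm primal}=r^\star$, and the supremum defining $r^{\rm primal}$ is attained. -/

import Mathlib

open MvPolynomial MeasureTheory

noncomputable section

/-- The formal Hessian matrix of a polynomial. -/
def polyHessian {m : ℕ} (h : MvPolynomial (Fin m) ℝ) :
    Matrix (Fin m) (Fin m) (MvPolynomial (Fin m) ℝ) :=
  Matrix.of fun i j => pderiv i (pderiv j h)

/-- `h` is s.o.s-convex: its Hessian factors as `Hᵀ H` for some `r × m` matrix polynomial `H`. -/
def SOSConvex {m : ℕ} (h : MvPolynomial (Fin m) ℝ) : Prop :=
  ∃ (r : ℕ) (H : Matrix (Fin r) (Fin m) (MvPolynomial (Fin m) ℝ)),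
    polyHessian h = H.transpose * H

/-- For a linear functional `L` on `ℝ[σ]` and a polynomial `q` in the variables `σ` with
coefficients in `ℝ[τ]`, the polynomial `∑_α L(σ^α) q_α ∈ ℝ[τ]`. -/
def applyFunctional {σ τ : Type*} (L : MvPolynomial σ ℝ →ₗ[ℝ] ℝ)
    (q : MvPolynomial σ (MvPolynomial τ ℝ)) : MvPolynomial τ ℝ :=
  ∑ α ∈ q.support, L (monomial α 1) • q.coeff α

/-- The dual cone of a set of polynomials: the linear functionals on the whole
polynomial ring which are nonnegative on that set. -/
def dualCone {σ : Type*} (K : Set (MvPolynomial σ ℝ)) : Set (MvPolynomial σ ℝ →ₗ[ℝ] ℝ) :=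
  {L | ∀ h ∈ K, 0 ≤ L h}

/-- The data of a fractional semi-infinite polynomial program
`min f(x)/g(x)` subject to `ψ_j(x) ≤ 0` for all `j`, and `p(x,y) ≤ 0` for all `y ∈ Y`,
with `x ∈ ℝ^m`, `y ∈ ℝ^n`. In `p` the variables `Sum.inl i` are the `x_i`
and the variables `Sum.inr k` are the `y_k`. -/
structure FSIPP (m n s : ℕ) where
  f : MvPolynomial (Fin m) ℝ
  g : MvPolynomial (Fin m) ℝ
  ψ : Fin s → MvPolynomial (Fin m) ℝ
  p : MvPolynomial (Fin m ⊕ Fin n) ℝ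
  Y : Set (Fin n → ℝ)

namespace FSIPP

variable {m n s : ℕ} (P : FSIPP m n s)

/-- The feasible set. -/
def K : Set (Fin m → ℝ) :=
  {x | (∀ j, eval x (P.ψ j) ≤ 0) ∧ ∀ y ∈ P.Y, eval (Sum.elim x y) P.p ≤ 0}

/-- The objective `f(x)/g(x)`. -/
def obj (x : Fin m → ℝ) : ℝ := eval x P.f / eval x P.g

/-- The set of optimal solutions. -/
def S : Set (Fin m → ℝ) := {x | x ∈ P.K ∧ ∀ z ∈ P.K, P.obj x ≤ P.obj z}

/-- The optimal value (only used when `S` is nonempty, so that it is a minimum). -/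
def rStar : ℝ := sInf (P.obj '' P.K)

/-- `p` as a polynomial in `x` with coefficients in `ℝ[y]`. -/
def pX : MvPolynomial (Fin m) (MvPolynomial (Fin n) ℝ) :=
  sumAlgEquiv ℝ (Fin m) (Fin n) P.p

/-- `p` as a polynomial in `y` with coefficients in `ℝ[x]`. -/
def pY : MvPolynomial (Fin n) (MvPolynomial (Fin m) ℝ) :=
  sumAlgEquiv ℝ (Fin n) (Fin m) (rename Sum.swap P.p)

/-- The polynomial `p(·, y) ∈ ℝ[x]` for a fixed point `y`. -/
def pAt (y : Fin n → ℝ) : MvPolynomial (Fin m) ℝ :=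
  aeval (Sum.elim X fun k => C (y k)) P.p

/-- The degree of `p` in `x`. -/
def dx : ℕ := P.pX.totalDegree

/-- The degree of `p` in `y`. -/
def dy : ℕ := P.pY.totalDegree

/-- The maximal degree in `x` of the data. -/
def d : ℕ :=
  max (max P.f.totalDegree P.g.totalDegree)
    (max (Finset.univ.sup fun j => (P.ψ j).totalDegree) P.dx)

/-- Assumption (A2). -/
def A2 : Prop :=
  (∀ x ∈ P.K, 0 ≤ eval x P.f ∧ 0 < eval x P.g) ∨
    (P.g.totalDegree ≤ 1 ∧ ∀ x ∈ P.K, 0 < eval x P.g)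

/-- The Lagrangian `f(x) - r* g(x) + ∫_Y p(x,y) dμ(y) + ∑_j η_j ψ_j(x)`. -/
def lagrangian (x : Fin m → ℝ) (μ : Measure (Fin n → ℝ)) (η : Fin s → ℝ) : ℝ :=
  eval x P.f - P.rStar * eval x P.g + (∫ y in P.Y, eval (Sum.elim x y) P.p ∂μ)
    + ∑ j, η j * eval x (P.ψ j)

/-- Assumption (A3): there are a finite nonnegative Borel measure `μ` supported on `Y` and
`η ≥ 0` such that the infimum of the Lagrangian over `ℝ^m` is `0`. -/
def A3 : Prop :=
  ∃ (μ : Measure (Fin n → ℝ)) (η : Fin s → ℝ), IsFiniteMeasure μ ∧ μ P.Yᶜ = 0 ∧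
    (∀ j, 0 ≤ η j) ∧ IsGLB (Set.range fun x => P.lagrangian x μ η) 0

/-- All the data are s.o.s-convex in `x`. -/
def SOSConvexData : Prop :=
  SOSConvex P.f ∧ SOSConvex (-P.g) ∧ (∀ j, SOSConvex (P.ψ j)) ∧ ∀ y ∈ P.Y, SOSConvex (P.pAt y)

/-- Case 1: `n = 1`, `Y = [-1,1]`, s.o.s-convex data; `i` is the only index in `Fin n`. -/
def IsCase1 (i : Fin n) : Prop :=
  n = 1 ∧ P.Y = {y | y i ∈ Set.Icc (-1) 1} ∧ P.SOSConvexData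

/-- Case 2: `n > 1`, `Y = {φ ≥ 0}` with `φ` of degree two and positive somewhere, `p` of degree
two in `y`, s.o.s-convex data. -/
def IsCase2 (φ : MvPolynomial (Fin n) ℝ) : Prop :=
  1 < n ∧ P.Y = {y | 0 ≤ eval y φ} ∧ φ.totalDegree = 2 ∧ (∃ y, 0 < eval y φ) ∧
    P.dy = 2 ∧ P.SOSConvexData

/-- The cone of sums of squares in `ℝ[x]` of degree at most `2d`. -/
def coneX : Set (MvPolynomial (Fin m) ℝ) :=
  {h | IsSumSq h ∧ h.totalDegree ≤ 2 * P.d}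

/-- The cone in `ℝ[y]` for Case 1; `(d_y + 1) / 2` is `⌈d_y/2⌉`. -/
def coneY1 (i : Fin n) : Set (MvPolynomial (Fin n) ℝ) :=
  {h | ∃ θ₀ θ₁ : MvPolynomial (Fin n) ℝ, IsSumSq θ₀ ∧ IsSumSq θ₁ ∧
    θ₀.totalDegree ≤ 2 * ((P.dy + 1) / 2) ∧
    (θ₁ * (1 - X i ^ 2)).totalDegree ≤ 2 * ((P.dy + 1) / 2) ∧
    h = θ₀ + θ₁ * (1 - X i ^ 2)}

/-- Feasibility of `(ρ, H, η)` in the primal conic problem with cones `Cx`, `Cy`. -/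
def PrimalFeasible (Cx : Set (MvPolynomial (Fin m) ℝ)) (Cy : Set (MvPolynomial (Fin n) ℝ))
    (ρ : ℝ) (H : MvPolynomial (Fin n) ℝ →ₗ[ℝ] ℝ) (η : Fin s → ℝ) : Prop :=
  P.f - ρ • P.g + applyFunctional H P.pY + ∑ j, η j • P.ψ j ∈ Cx ∧
    H ∈ dualCone Cy ∧ ∀ j, 0 ≤ η j

/-- The optimal value of the primal conic problem, a supremum in `[-∞, ∞]`. -/
def rPrimal (Cx : Set (MvPolynomial (Fin m) ℝ)) (Cy : Set (MvPolynomial (Fin n) ℝ)) : EReal :=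
  sSup {r | ∃ ρ H η, P.PrimalFeasible Cx Cy ρ H η ∧ r = (ρ : EReal)}

/-- Feasibility of `L` in the dual conic problem with cones `Cx`, `Cy`. -/
def DualFeasible (Cx : Set (MvPolynomial (Fin m) ℝ)) (Cy : Set (MvPolynomial (Fin n) ℝ))
    (L : MvPolynomial (Fin m) ℝ →ₗ[ℝ] ℝ) : Prop :=
  L ∈ dualCone Cx ∧ L P.g = 1 ∧ -applyFunctional L P.pX ∈ Cy ∧ ∀ j, L (P.ψ j) ≤ 0

/-- The optimal value of the dual conic problem, an infimum in `[-∞, ∞]`. -/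
def rDual (Cx : Set (MvPolynomial (Fin m) ℝ)) (Cy : Set (MvPolynomial (Fin n) ℝ)) : EReal :=
  sInf {r | ∃ L, P.DualFeasible Cx Cy L ∧ r = (L P.f : EReal)}

/-- `L` is a minimizer of the dual conic problem. -/
def IsDualMinimizer (Cx : Set (MvPolynomial (Fin m) ℝ)) (Cy : Set (MvPolynomial (Fin n) ℝ))
    (L : MvPolynomial (Fin m) ℝ →ₗ[ℝ] ℝ) : Prop :=
  P.DualFeasible Cx Cy L ∧ ∀ L', P.DualFeasible Cx Cy L' → L P.f ≤ L' P.f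

end FSIPP

/-- The cone in `ℝ[y]` for Case 2. -/
def coneY2 {n : ℕ} (φ : MvPolynomial (Fin n) ℝ) : Set (MvPolynomial (Fin n) ℝ) :=
  {h | ∃ (θ : MvPolynomial (Fin n) ℝ) (c : ℝ), IsSumSq θ ∧ θ.totalDegree ≤ 2 ∧ 0 ≤ c ∧
    h = θ + c • φ}

end

/-! ### Sums of squares -/

/-! Two facts carry the proof. The first concerns x: the remainder `h - h(a) - ∇h(a)ᵀ(x - a)` of an
s.o.s-convex polynomial is a sum of squares of degree at most `deg h`, by Taylor's formula with
integral remainder (`SOSConvex.isSumSq_firstOrderRemainder`). The second concerns y: members of the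
cone are nonnegative on `Y`, and every polynomial of degree at most `d_y` that is nonnegative on `Y`
lies in the cone. This is a degree-controlled representation on `[-1, 1]` in Case 1
(`exists_isSumSq_of_nonneg_Icc`) and the S-lemma in Case 2 (`exists_isSumSq_add_smul_of_nonneg`).

Dual problem: a feasible `L` has `L 1 > 0`. Applied to the remainder at `a = L(x)/L(1)`, it kills
the linear part and leaves Jensen's inequality `L(1) h(a) ≤ L(h)`. So `a` is feasible for the
program with objective at most `L(f)`. Conversely, evaluation at a feasible point divided by the
value of `g` is dual feasible with the same objective.

Primal problem: with the multipliers of (A3) the Lagrangian is nonnegative and vanishes at a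
minimizer `x`. Its gradient vanishes there too, so it equals its own remainder at `x`. That
remainder is linear in the data, hence a sum of elements of the cone. The integral term is handled
by writing it as a multiple of a point of the convex hull of `{p(·, y)}`. -/

theorem IsSumSq.map_ringHom {A B : Type*} [CommRing A] [CommRing B] (F : A →+* B) {s : A}
    (hs : IsSumSq s) : IsSumSq (F s) := by
  induction hs with
  | zero => simp
  | sq_add a _ ih => simpa using ih.sq_add (F a)

theorem IsSumSq.algebraMap_of_nonneg {A : Type*} [CommRing A] [Algebra ℝ A] {c : ℝ} (hc : 0 ≤ c) :
    IsSumSq (algebraMap ℝ A c) := by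
  rw [← Real.mul_self_sqrt hc, map_mul]
  exact IsSumSq.mul_self _

theorem IsSumSq.smul_of_nonneg {A : Type*} [CommRing A] [Algebra ℝ A] {c : ℝ} (hc : 0 ≤ c) {s : A}
    (hs : IsSumSq s) : IsSumSq (c • s) := by
  rw [Algebra.smul_def]
  exact (IsSumSq.algebraMap_of_nonneg hc).mul hs

theorem IsSumSq.eval_nonneg {σ : Type*} {h : MvPolynomial σ ℝ} (hs : IsSumSq h) (x : σ → ℝ) :
    0 ≤ eval x h :=
  (hs.map_ringHom (eval x)).nonneg

/-- A positive semidefinite quadratic form evaluated at a vector of elements of a commutative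
real algebra is a sum of squares. -/
theorem isSumSq_of_posSemidef {ι A : Type*} [Fintype ι] [CommRing A] [Algebra ℝ A]
    {M : Matrix ι ι ℝ} (hM : M.PosSemidef) (v : ι → A) :
    IsSumSq (∑ i, ∑ j, M i j • (v i * v j)) := by
  classical
  open scoped MatrixOrder Matrix.Norms.L2Operator in
  obtain ⟨B, rfl⟩ := CStarAlgebra.nonneg_iff_eq_star_mul_self.mp hM.nonneg
  have : ∑ i, ∑ j, (star B * B) i j • (v i * v j)
      = ∑ k, (∑ i, B k i • v i) * (∑ i, B k i • v i) := by
    simp only [Matrix.mul_apply, Matrix.star_apply, star_trivial, Finset.sum_smul,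
      Finset.sum_mul_sum, smul_mul_smul_comm]
    rw [Finset.sum_congr rfl fun i _ => Finset.sum_comm, Finset.sum_comm]
  rw [this]
  exact IsSumSq.sum_mul_self _ _

/-! ### Convex hulls of compact sets -/

/-- By Carathéodory the hull is the continuous image of a simplex times a finite power of `s`. It is
used to know that the hull is closed, so that averages stay inside it. -/
theorem IsCompact.convexHull_of_finiteDimensional {E : Type*} [NormedAddCommGroup E]
    [NormedSpace ℝ E] [FiniteDimensional ℝ E] {s : Set E} (hs : IsCompact s) :
    IsCompact (convexHull ℝ s) := by
  rcases s.eq_empty_or_nonempty with rfl | ⟨e, he⟩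
  · simp
  let N := Module.finrank ℝ E + 1
  let F : (Fin N → ℝ) × (Fin N → E) → E := fun q => ∑ i, q.1 i • q.2 i
  have hF : Continuous F := by fun_prop
  have hc : IsCompact (stdSimplex ℝ (Fin N) ×ˢ Set.univ.pi fun _ : Fin N => s) :=
    (isCompact_stdSimplex ℝ (Fin N)).prod (isCompact_univ_pi fun _ => hs)
  convert hc.image hF
  apply Set.Subset.antisymm
  · intro x hx
    obtain ⟨ι, _, z, w, hz, hind, hw, hw1, rfl⟩ := eq_pos_convex_span_of_mem_convexHull hx
    have hcard : Fintype.card ι ≤ N := by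
      refine hind.card_le_finrank_succ.trans ?_
      exact Nat.succ_le_succ (Submodule.finrank_le _)
    obtain ⟨g⟩ := Function.Embedding.nonempty_of_card_le (α := ι) (β := Fin N)
      (by simpa using hcard)
    have hg := g.injective
    -- Carathéodory may give fewer than `N` points; the list is padded with weight zero and the
    -- spare point `e`.
    refine ⟨(Function.extend g w 0, Function.extend g z fun _ => e),
      ⟨⟨fun i => ?_, ?_⟩, fun i _ => ?_⟩, ?_⟩
    · by_cases hi : ∃ a, g a = i
      · obtain ⟨a, rfl⟩ := hi
        simpa [hg.extend_apply] using (hw a).le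
      · simp [Function.extend_apply' _ _ _ hi]
    · rw [← hw1]
      refine (Fintype.sum_of_injective g hg _ _ (fun i hi => ?_) fun a => ?_).symm
      · exact Function.extend_apply' _ _ _ hi
      · exact (hg.extend_apply _ _ _).symm
    · by_cases hi : ∃ a, g a = i
      · obtain ⟨a, rfl⟩ := hi
        simpa [hg.extend_apply] using hz ⟨a, rfl⟩
      · simpa [Function.extend_apply' _ _ _ hi] using he
    · refine (Fintype.sum_of_injective g hg _ _ (fun i hi => ?_) fun a => ?_).symm
      · simp [Function.extend_apply' _ _ _ hi]
      · simp [hg.extend_apply]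
  · rintro _ ⟨⟨w, z⟩, ⟨⟨hw, hw1⟩, hz⟩, rfl⟩
    exact (convex_convexHull ℝ s).sum_mem (fun i _ => hw i) hw1
      fun i _ => subset_convexHull ℝ s (hz i trivial)

noncomputable section

/-! ### First-order remainders of s.o.s-convex polynomials -/

/-- The chain rule for a polynomial evaluated at univariate polynomials. -/
theorem derivative_aeval {σ A : Type*} [Fintype σ] [CommRing A] [Algebra ℝ A]
    (g : σ → Polynomial A) (h : MvPolynomial σ ℝ) :
    Polynomial.derivative (aeval g h)
      = ∑ i, aeval g (pderiv i h) * Polynomial.derivative (g i) := by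
  classical
  induction h using MvPolynomial.induction_on with
  | C a => simp [IsScalarTower.algebraMap_apply ℝ A (Polynomial A)]
  | add p q hp hq => simp [hp, hq, add_mul, Finset.sum_add_distrib]
  | mul_X p j hp =>
    simp only [map_mul, aeval_X, Polynomial.derivative_mul, hp, pderiv_mul, map_add, pderiv_X,
      add_mul, Finset.sum_add_distrib]
    congr 1
    · rw [Finset.sum_mul]
      exact Finset.sum_congr rfl fun i _ => by ring
    · rw [Finset.sum_eq_single j]
      · simp
      · intro i _ hij
        simp [hij.symm]
      · simp

theorem eval_aeval_polynomial {σ A : Type*} [CommRing A] [Algebra ℝ A]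
    (g : σ → Polynomial A) (h : MvPolynomial σ ℝ) (t : A) :
    (aeval g h).eval t = aeval (fun i => (g i).eval t) h := by
  induction h using MvPolynomial.induction_on with
  | C a => simp [IsScalarTower.algebraMap_apply ℝ A (Polynomial A)]
  | add p q hp hq => simp [hp, hq]
  | mul_X p j hp => simp [hp]

/-- The linear functional `u ↦ ∫₀¹ (1 - s) u(s) ds` on univariate polynomials over `A`. -/
def taylorFunctional (A : Type*) [CommRing A] [Algebra ℝ A] : Polynomial A →ₗ[ℝ] A where
  toFun u := u.sum fun j a => ((1 : ℝ) / ((j + 1) * (j + 2))) • a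
  map_add' u v := by
    rw [Polynomial.sum_add_index] <;> simp
  map_smul' c u := by
    rw [Polynomial.sum_smul_index']
    · simp [Polynomial.sum, Finset.smul_sum, smul_comm c]
    · simp

theorem taylorFunctional_monomial {A : Type*} [CommRing A] [Algebra ℝ A] (j : ℕ) (a : A) :
    taylorFunctional A (Polynomial.monomial j a) = ((1 : ℝ) / ((j + 1) * (j + 2))) • a := by
  simp [taylorFunctional, Polynomial.sum_monomial_index]

/-- Taylor's formula with integral remainder. -/
theorem taylorFunctional_derivative_derivative {A : Type*} [CommRing A] [Algebra ℝ A]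
    (u : Polynomial A) :
    taylorFunctional A (Polynomial.derivative (Polynomial.derivative u))
      = u.eval 1 - u.eval 0 - (Polynomial.derivative u).eval 0 := by
  induction u using Polynomial.induction_on' with
  | add p q hp hq => simp only [map_add, Polynomial.eval_add, hp, hq]; ring
  | monomial l a =>
    rcases l with _ | _ | l
    · simp
    · simp
    · simp only [Polynomial.derivative_monomial, taylorFunctional_monomial,
        Polynomial.eval_monomial]
      simp only [Nat.add_sub_cancel]
      have h1 : a * ((l + 1 + 1 : ℕ) : A) * ((l + 1 : ℕ) : A)
          = (((l : ℝ) + 1) * (l + 2)) • a := by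
        rw [Algebra.smul_def]
        simp only [map_mul, map_add, map_natCast, map_one, map_ofNat]
        push_cast
        ring
      rw [h1, smul_smul]
      have h2 : ((l : ℝ) + 1) * (l + 2) ≠ 0 := by positivity
      rw [one_div, inv_mul_cancel₀ h2]
      simp

theorem integral_one_sub_mul_pow (j : ℕ) :
    ∫ s in (0 : ℝ)..1, (1 - s) * s ^ j = 1 / ((j + 1) * (j + 2)) := by
  have h : ∀ s : ℝ, (1 - s) * s ^ j = s ^ j - s ^ (j + 1) := fun s => by ring
  simp only [h]
  rw [intervalIntegral.integral_sub (by simp) (by simp), integral_pow, integral_pow]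
  have h1 : (j : ℝ) + 1 ≠ 0 := by positivity
  have h2 : (j : ℝ) + 2 ≠ 0 := by positivity
  push_cast
  simp only [one_pow, zero_pow (Nat.succ_ne_zero _)]
  field_simp
  ring

/-- The Gram matrix of the monomials `1, s, …, s^(N-1)` for the weight `1 - s` on `[0, 1]`. -/
def taylorGram (N : ℕ) : Matrix (Fin N) (Fin N) ℝ :=
  Matrix.of fun j l => 1 / (((j + l : ℕ) + 1) * ((j + l : ℕ) + 2))

/-- The form at `c` is `∫₀¹ (1 - s) (∑ c_j s^j)² ds`. -/
theorem taylorGram_posSemidef (N : ℕ) : (taylorGram N).PosSemidef := by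
  refine Matrix.PosSemidef.of_dotProduct_mulVec_nonneg ?_ fun c => ?_
  · ext j l
    simp [taylorGram, add_comm]
  have hint : ∫ s in (0 : ℝ)..1, (1 - s) * (∑ j : Fin N, c j * s ^ (j : ℕ)) ^ 2
      = star c ⬝ᵥ (taylorGram N).mulVec c := by
    have h : ∀ s : ℝ, (1 - s) * (∑ j : Fin N, c j * s ^ (j : ℕ)) ^ 2
        = ∑ j : Fin N, ∑ l : Fin N, c j * c l * ((1 - s) * s ^ (j + l : ℕ)) := by
      intro s
      rw [sq, Finset.sum_mul_sum, Finset.mul_sum]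
      refine Finset.sum_congr rfl fun j _ => ?_
      rw [Finset.mul_sum]
      exact Finset.sum_congr rfl fun l _ => by ring
    simp only [h]
    rw [intervalIntegral.integral_finsetSum fun j _ =>
      Continuous.intervalIntegrable (by fun_prop) _ _]
    simp only [dotProduct, Matrix.mulVec, star_trivial]
    refine Finset.sum_congr rfl fun j _ => ?_
    rw [intervalIntegral.integral_finsetSum fun j _ =>
      Continuous.intervalIntegrable (by fun_prop) _ _, Finset.mul_sum]
    refine Finset.sum_congr rfl fun l _ => ?_
    rw [intervalIntegral.integral_const_mul, integral_one_sub_mul_pow]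
    simp only [taylorGram, Matrix.of_apply]
    ring
  rw [← hint]
  refine intervalIntegral.integral_nonneg (by norm_num) fun s hs => ?_
  exact mul_nonneg (by linarith [hs.2]) (sq_nonneg _)

/-- The value is the Gram form in the coefficients of `u`, so positivity of a real matrix replaces
pointwise integration, which has no meaning over a bare algebra `A`. -/
theorem isSumSq_taylorFunctional_mul_self {A : Type*} [CommRing A] [Algebra ℝ A]
    (u : Polynomial A) : IsSumSq (taylorFunctional A (u * u)) := by
  have h : taylorFunctional A (u * u) = ∑ j : Fin (u.natDegree + 1),
      ∑ l : Fin (u.natDegree + 1), taylorGram _ j l • (u.coeff j * u.coeff l) := by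
    conv_lhs => rw [u.as_sum_range, Finset.sum_range, Finset.sum_mul_sum]
    simp only [Polynomial.monomial_mul_monomial, map_sum, taylorFunctional_monomial]
    rfl
  rw [h]
  exact isSumSq_of_posSemidef (taylorGram_posSemidef _) _

variable {m : ℕ}

/-- The remainder `h - h(a) - ∇h(a)ᵀ (x - a)`, as a linear map in `h`. -/
def firstOrderRemainder (a : Fin m → ℝ) : MvPolynomial (Fin m) ℝ →ₗ[ℝ] MvPolynomial (Fin m) ℝ where
  toFun h := h - C (eval a h) - ∑ i, C (eval a (pderiv i h)) * (X i - C (a i))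
  map_add' h k := by
    simp only [map_add, add_mul, Finset.sum_add_distrib]
    ring
  map_smul' c h := by
    simp only [smul_eq_C_mul, pderiv_C_mul, map_mul, eval_C, RingHom.id_apply, mul_sub,
      Finset.mul_sum, mul_assoc]

theorem firstOrderRemainder_apply (a : Fin m → ℝ) (h : MvPolynomial (Fin m) ℝ) :
    firstOrderRemainder a h
      = h - C (eval a h) - ∑ i, C (eval a (pderiv i h)) * (X i - C (a i)) := rfl

/-- Restrict `h` to the segment `γ(t) = a + t(x - a)` with `x` kept as indeterminates. The second
derivative in `t` is `∑_k (∑_i H_ki(γ)(x_i - a_i))²`, and Taylor's formula expresses the remainder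
as `taylorFunctional` of it. -/
theorem SOSConvex.isSumSq_firstOrderRemainder {h : MvPolynomial (Fin m) ℝ} (hh : SOSConvex h)
    (a : Fin m → ℝ) : IsSumSq (firstOrderRemainder a h) := by
  obtain ⟨r, H, hH⟩ := hh
  let A := MvPolynomial (Fin m) ℝ
  let γ : Fin m → Polynomial A := fun i =>
    Polynomial.C (C (a i)) + Polynomial.X * Polynomial.C (X i - C (a i))
  have hγ : ∀ i, Polynomial.derivative (γ i) = Polynomial.C (X i - C (a i)) := by
    intro i; simp [γ]
  have h1 : ∀ q : A, (aeval γ q : Polynomial A).eval 1 = q := by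
    intro q
    rw [eval_aeval_polynomial]
    have : (fun i => (γ i).eval 1) = X := by ext1 i; simp [γ]
    rw [this, aeval_X_left_apply]
  have h0 : ∀ q : A, (aeval γ q : Polynomial A).eval 0 = C (eval a q) := by
    intro q
    rw [eval_aeval_polynomial]
    have : (fun i => (γ i).eval 0) = algebraMap ℝ A ∘ a := by
      ext1 i; simp [γ, A, MvPolynomial.algebraMap_eq]
    rw [this, aeval_algebraMap_apply, MvPolynomial.algebraMap_eq, aeval_eq_eval]
  have hT := taylorFunctional_derivative_derivative (aeval γ h : Polynomial A)
  have hD : Polynomial.derivative (aeval γ h : Polynomial A)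
      = ∑ i, aeval γ (pderiv i h) * Polynomial.C (X i - C (a i)) := by
    rw [derivative_aeval]; simp only [hγ]
  have hR : (aeval γ h : Polynomial A).eval 1 - (aeval γ h : Polynomial A).eval 0
      - (Polynomial.derivative (aeval γ h : Polynomial A)).eval 0 = firstOrderRemainder a h := by
    rw [h1, h0, hD, Polynomial.eval_finsetSum, firstOrderRemainder_apply]
    simp only [Polynomial.eval_mul, h0, Polynomial.eval_C]
  have hDD : Polynomial.derivative (Polynomial.derivative (aeval γ h : Polynomial A))
      = ∑ k, (∑ i, aeval γ (H k i) * Polynomial.C (X i - C (a i)))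
        * (∑ i, aeval γ (H k i) * Polynomial.C (X i - C (a i))) := by
    have hent : ∀ i j, pderiv i (pderiv j h) = ∑ k, H k i * H k j := by
      intro i j
      have := congrFun (congrFun hH i) j
      simpa [polyHessian, Matrix.mul_apply] using this
    rw [hD, Polynomial.derivative_sum]
    simp only [Polynomial.derivative_mul, Polynomial.derivative_C, mul_zero, add_zero,
      derivative_aeval, hγ, hent, map_sum, map_mul, Finset.sum_mul, Finset.mul_sum]
    rw [Finset.sum_congr rfl fun i _ => Finset.sum_comm, Finset.sum_comm]
    refine Finset.sum_congr rfl fun k _ => Finset.sum_congr rfl fun i _ =>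
      Finset.sum_congr rfl fun j _ => ?_
    rw [mul_mul_mul_comm, mul_assoc, mul_comm (aeval γ (H k j))]
  rw [← hR, ← hT, hDD, map_sum]
  exact IsSumSq.sum fun k _ => isSumSq_taylorFunctional_mul_self _

theorem totalDegree_firstOrderRemainder_le (a : Fin m → ℝ) (h : MvPolynomial (Fin m) ℝ) :
    (firstOrderRemainder a h).totalDegree ≤ h.totalDegree := by
  rw [firstOrderRemainder_apply]
  rcases Nat.eq_zero_or_pos h.totalDegree with h0 | h0
  · rw [totalDegree_eq_zero_iff_eq_C.1 h0]
    simp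
  refine (totalDegree_sub _ _).trans (max_le ((totalDegree_sub _ _).trans (by simp)) ?_)
  refine totalDegree_finsetSum_le fun i _ => (totalDegree_mul _ _).trans ?_
  rw [totalDegree_C, zero_add]
  exact (totalDegree_sub _ _).trans (by simpa using Nat.succ_le_of_lt h0)

/-- Makes an affine `g` s.o.s-convex along with `-g`; this serves the second alternative of (A2). -/
theorem sosConvex_of_totalDegree_le_one {h : MvPolynomial (Fin m) ℝ} (hd : h.totalDegree ≤ 1) :
    SOSConvex h := by
  refine ⟨0, 0, ?_⟩
  refine Matrix.ext fun i j => ?_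
  simp only [polyHessian, Matrix.of_apply, Matrix.mul_zero, Matrix.zero_apply]
  refine MvPolynomial.ext _ _ fun α => ?_
  rw [coeff_pderiv, coeff_pderiv, coeff_zero, coeff_eq_zero_of_totalDegree_lt, zero_mul, zero_mul]
  refine lt_of_le_of_lt hd ?_
  change 1 < Finsupp.degree _
  simp [map_add]

/-- A polynomial equals its first-order remainder at a zero which minimizes it. -/
theorem firstOrderRemainder_eq_self {h : MvPolynomial (Fin m) ℝ} {a : Fin m → ℝ}
    (hpos : ∀ x, 0 ≤ eval x h) (ha : eval a h = 0) : firstOrderRemainder a h = h := by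
  classical
  have hgrad : ∀ i, eval a (pderiv i h) = 0 := by
    intro i
    -- Along the line through `a` in direction `e_i` the restriction of `h` has a minimum at `0`.
    let γ : Fin m → Polynomial ℝ := fun j =>
      Polynomial.C (a j) + Polynomial.X * Polynomial.C ((Pi.single i 1 : Fin m → ℝ) j)
    have hγ' : ∀ j, (Polynomial.derivative (γ j)).eval 0 = (Pi.single i 1 : Fin m → ℝ) j := by
      intro j
      simp only [γ, Polynomial.derivative_add, Polynomial.derivative_mul, Polynomial.derivative_C,
        Polynomial.derivative_X, mul_zero, add_zero, zero_add, one_mul, Polynomial.eval_C]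
    have hev : ∀ (q : MvPolynomial (Fin m) ℝ) (t : ℝ),
        (aeval γ q : Polynomial ℝ).eval t = eval (fun j => (γ j).eval t) q := by
      intro q t
      rw [eval_aeval_polynomial, aeval_eq_eval]
    have hγ0 : (fun j => (γ j).eval 0) = a := by ext j; simp [γ]
    have hmin : IsLocalMin (fun t => (aeval γ h : Polynomial ℝ).eval t) 0 := by
      refine Filter.Eventually.of_forall fun t => ?_
      simp only [hev, hγ0, ha]
      exact hpos _
    have hd := hmin.deriv_eq_zero
    rw [Polynomial.deriv, derivative_aeval, Polynomial.eval_finsetSum] at hd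
    simpa [Polynomial.eval_mul, hev, hγ0, hγ', Pi.single_apply] using hd
  simp [firstOrderRemainder_apply, ha, hgrad]

end

/-! ### Polynomials nonnegative on an interval -/

namespace Polynomial

/-- After division by a power of `x - c` the sign is known only off `c`; density recovers it at `c`.
-/
theorem eval_nonneg_Icc_of_forall_ne {q : Polynomial ℝ} {a b c : ℝ} (hab : a < b)
    (h : ∀ x ∈ Set.Icc a b, x ≠ c → 0 ≤ q.eval x) : ∀ x ∈ Set.Icc a b, 0 ≤ q.eval x := by
  have hcl : IsClosed {x : ℝ | 0 ≤ q.eval x} := isClosed_le continuous_const q.continuous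
  have hd : Dense ({c}ᶜ : Set ℝ) := dense_compl_singleton c
  have hsub : Set.Ioo a b ∩ {c}ᶜ ⊆ {x : ℝ | 0 ≤ q.eval x} := fun x hx =>
    h x (Set.Ioo_subset_Icc_self hx.1) hx.2
  have h1 : Set.Icc a b ⊆ closure (Set.Ioo a b ∩ {c}ᶜ) := by
    rw [← closure_Ioo hab.ne]
    exact closure_minimal (hd.open_subset_closure_inter isOpen_Ioo) isClosed_closure
  exact fun x hx => closure_minimal hsub hcl (h1 hx)

/-- Subtracting from `q` its minimum over `[-1, 1]` leaves a polynomial divisible by `1 - X`, by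
`1 + X` or by a square, with a cofactor which is nonnegative on `[-1, 1]`. -/
theorem exists_cofactor_of_nonneg_Icc {q : Polynomial ℝ} {d : ℕ} (hd : q.natDegree ≤ d + 1)
    (hq : ∀ x ∈ Set.Icc (-1 : ℝ) 1, 0 ≤ q.eval x) :
    ∃ c : ℝ, 0 ≤ c ∧ ∃ r : Polynomial ℝ, (∀ x ∈ Set.Icc (-1 : ℝ) 1, 0 ≤ r.eval x) ∧
      ((r.natDegree ≤ d ∧ (q = C c + (1 - X) * r ∨ q = C c + (1 + X) * r)) ∨
        ((d = 0 → r = 0) ∧ r.natDegree ≤ d - 1 ∧ ∃ a : ℝ, q = C c + (X - C a) ^ 2 * r)) := by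
  obtain ⟨a, ha, hmin⟩ := isCompact_Icc.exists_isMinOn
    (Set.nonempty_Icc.2 (by norm_num : (-1 : ℝ) ≤ 1)) q.continuous.continuousOn
  have hdvd : (X - C a) ∣ q - C (q.eval a) := by simp [dvd_iff_isRoot]
  obtain ⟨t, ht⟩ := hdvd
  have htd : t.natDegree ≤ d := by
    by_cases h0 : t = 0
    · simp [h0]
    have h1 : (q - C (q.eval a)).natDegree ≤ d + 1 := by simpa using hd
    rw [ht, natDegree_mul (X_sub_C_ne_zero a) h0, natDegree_X_sub_C] at h1
    omega
  have hev : ∀ x ∈ Set.Icc (-1 : ℝ) 1, 0 ≤ (x - a) * t.eval x := by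
    intro x hx
    have h1 := congrArg (eval x) ht
    simp only [eval_sub, eval_C, eval_mul, eval_X] at h1
    rw [← h1]
    exact sub_nonneg.2 (hmin hx)
  refine ⟨q.eval a, hq a ha, ?_⟩
  have hq' : q = C (q.eval a) + (X - C a) * t := by rw [← ht]; ring
  rcases eq_or_ne a 1 with rfl | ha1
  · refine ⟨-t, eval_nonneg_Icc_of_forall_ne (c := 1) (by norm_num) fun x hx hx1 => ?_,
      Or.inl ⟨by simpa using htd, Or.inl ?_⟩⟩
    · have := hev x hx
      have h2 : x - 1 < 0 := sub_neg.2 (lt_of_le_of_ne hx.2 hx1)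
      rw [eval_neg]
      nlinarith
    · conv_lhs => rw [hq']
      rw [C_1]; ring
  rcases eq_or_ne a (-1) with rfl | ha2
  · refine ⟨t, eval_nonneg_Icc_of_forall_ne (c := -1) (by norm_num) fun x hx hx1 => ?_,
      Or.inl ⟨htd, Or.inr ?_⟩⟩
    · have := hev x hx
      have h2 : 0 < x - -1 := sub_pos.2 (lt_of_le_of_ne hx.1 (Ne.symm hx1))
      exact nonneg_of_mul_nonneg_right this h2
    · conv_lhs => rw [hq']
      rw [C_neg, C_1]; ring
  have hlt1 : a < 1 := lt_of_le_of_ne ha.2 ha1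
  have hlt2 : -1 < a := lt_of_le_of_ne ha.1 (Ne.symm ha2)
  -- At an interior minimum `t` is nonpositive to the left of `a` and nonnegative to the right, so
  -- `a` is a double root of `q - q(a)`.
  have hta : t.eval a = 0 := by
    apply le_antisymm
    · have := eval_nonneg_Icc_of_forall_ne (q := -t) (c := a) hlt2 (fun x hx hxa => by
        have := hev x ⟨hx.1, hx.2.trans hlt1.le⟩
        have h2 : x - a < 0 := sub_neg.2 (lt_of_le_of_ne hx.2 hxa)
        rw [eval_neg]
        nlinarith) a ⟨hlt2.le, le_rfl⟩
      simpa using this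
    · exact eval_nonneg_Icc_of_forall_ne (q := t) (c := a) hlt1 (fun x hx hxa => by
        have := hev x ⟨hlt2.le.trans hx.1, hx.2⟩
        have h2 : 0 < x - a := sub_pos.2 (lt_of_le_of_ne hx.1 (Ne.symm hxa))
        exact nonneg_of_mul_nonneg_right this h2) a ⟨le_rfl, hlt1.le⟩
  obtain ⟨r, hr⟩ : (X - C a) ∣ t := dvd_iff_isRoot.2 hta
  refine ⟨r, eval_nonneg_Icc_of_forall_ne (c := a) (by norm_num) fun x hx hxa => ?_,
      Or.inr ⟨?_, ?_, a, ?_⟩⟩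
  · have := hev x hx
    have h2 : 0 < (x - a) ^ 2 := by have := sub_ne_zero.2 hxa; positivity
    rw [hr, eval_mul, eval_sub, eval_X, eval_C, ← mul_assoc, ← sq] at this
    exact nonneg_of_mul_nonneg_right this h2
  · intro h0
    by_contra hr0
    rw [hr, natDegree_mul (X_sub_C_ne_zero a) hr0, natDegree_X_sub_C] at htd
    omega
  · by_cases hr0 : r = 0
    · simp [hr0]
    rw [hr, natDegree_mul (X_sub_C_ne_zero a) hr0, natDegree_X_sub_C] at htd
    omega
  · conv_lhs => rw [hq', hr]
    ring

/-- The representation of a polynomial of even degree `2 k` on `[-1, 1]`. -/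
def EvenRep (k : ℕ) (q : Polynomial ℝ) : Prop :=
  ∃ s t : Polynomial ℝ, IsSumSq s ∧ IsSumSq t ∧ s.natDegree ≤ 2 * k ∧ t.natDegree ≤ 2 * k - 2 ∧
    (k = 0 → t = 0) ∧ q = s + t * (1 - X ^ 2)

/-- The representation of a polynomial of odd degree `2 k + 1` on `[-1, 1]`. -/
def OddRep (k : ℕ) (q : Polynomial ℝ) : Prop :=
  ∃ s t : Polynomial ℝ, IsSumSq s ∧ IsSumSq t ∧ s.natDegree ≤ 2 * k ∧ t.natDegree ≤ 2 * k ∧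
    q = s * (1 - X) + t * (1 + X)

theorem natDegree_add_le_of {p q : Polynomial ℝ} {d : ℕ} (hp : p.natDegree ≤ d)
    (hq : q.natDegree ≤ d) : (p + q).natDegree ≤ d :=
  (natDegree_add_le p q).trans (max_le hp hq)

theorem natDegree_sq_mul_le {l s : Polynomial ℝ} {d : ℕ} (hl : l.natDegree ≤ 1)
    (hs : s.natDegree ≤ d) : (l ^ 2 * s).natDegree ≤ d + 2 := by
  have h1 := natDegree_mul_le (p := l ^ 2) (q := s)
  have h2 := natDegree_pow_le (p := l) (n := 2)
  omega

theorem natDegree_one_sub_X : (1 - X : Polynomial ℝ).natDegree ≤ 1 :=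
  (natDegree_sub_le _ _).trans (by simp)

theorem natDegree_one_add_X : (1 + X : Polynomial ℝ).natDegree ≤ 1 :=
  (natDegree_add_le _ _).trans (by simp)

theorem EvenRep.C_add {k : ℕ} {q : Polynomial ℝ} (h : EvenRep k q) {c : ℝ} (hc : 0 ≤ c) :
    EvenRep k (C c + q) := by
  obtain ⟨s, t, hs, ht, hsd, htd, h0, rfl⟩ := h
  exact ⟨C c + s, t, (IsSumSq.algebraMap_of_nonneg hc).add hs, ht,
    natDegree_add_le_of (by simp) hsd, htd, h0, by ring⟩

theorem OddRep.C_add {k : ℕ} {q : Polynomial ℝ} (h : OddRep k q) {c : ℝ} (hc : 0 ≤ c) :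
    OddRep k (C c + q) := by
  obtain ⟨s, t, hs, ht, hsd, htd, rfl⟩ := h
  have hc2 : IsSumSq (C (c / 2) : Polynomial ℝ) :=
    IsSumSq.algebraMap_of_nonneg (A := Polynomial ℝ) (by positivity : 0 ≤ c / 2)
  refine ⟨C (c / 2) + s, C (c / 2) + t, hc2.add hs, hc2.add ht,
    natDegree_add_le_of (by simp) hsd, natDegree_add_le_of (by simp) htd, ?_⟩
  have : (C c : Polynomial ℝ) = C (c / 2) + C (c / 2) := by rw [← Polynomial.C_add, add_halves]
  rw [this]
  ring

theorem EvenRep.sq_mul {k : ℕ} {q l : Polynomial ℝ} (h : EvenRep k q) (hl : l.natDegree ≤ 1) :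
    EvenRep (k + 1) (l ^ 2 * q) := by
  obtain ⟨s, t, hs, ht, hsd, htd, h0, rfl⟩ := h
  have hl2 : IsSumSq (l ^ 2) := by rw [sq]; exact IsSumSq.mul_self l
  refine ⟨l ^ 2 * s, l ^ 2 * t, hl2.mul hs, hl2.mul ht, natDegree_sq_mul_le hl hsd, ?_,
    by simp, by ring⟩
  rcases Nat.eq_zero_or_pos k with rfl | hk
  · simp [h0 rfl]
  · refine (natDegree_sq_mul_le hl htd).trans (by omega)

theorem OddRep.sq_mul {k : ℕ} {q l : Polynomial ℝ} (h : OddRep k q) (hl : l.natDegree ≤ 1) :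
    OddRep (k + 1) (l ^ 2 * q) := by
  obtain ⟨s, t, hs, ht, hsd, htd, rfl⟩ := h
  have hl2 : IsSumSq (l ^ 2) := by rw [sq]; exact IsSumSq.mul_self l
  exact ⟨l ^ 2 * s, l ^ 2 * t, hl2.mul hs, hl2.mul ht, natDegree_sq_mul_le hl hsd,
    natDegree_sq_mul_le hl htd, by ring⟩

/-- A factor `1 ∓ X` switches parity: it turns one of the weights `1 - X`, `1 + X` into a square and
the other into `1 - X²`. In the other direction, `(1 - X)(1 - X²) = (1 - X)²(1 + X)`. -/
theorem OddRep.one_sub_X_mul {k : ℕ} {q : Polynomial ℝ} (h : OddRep k q) :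
    EvenRep (k + 1) ((1 - X) * q) := by
  obtain ⟨s, t, hs, ht, hsd, htd, rfl⟩ := h
  have hl2 : IsSumSq ((1 - X : Polynomial ℝ) ^ 2) := by rw [sq]; exact IsSumSq.mul_self _
  exact ⟨(1 - X) ^ 2 * s, t, hl2.mul hs, ht, natDegree_sq_mul_le natDegree_one_sub_X hsd, htd,
    by simp, by ring⟩

theorem OddRep.one_add_X_mul {k : ℕ} {q : Polynomial ℝ} (h : OddRep k q) :
    EvenRep (k + 1) ((1 + X) * q) := by
  obtain ⟨s, t, hs, ht, hsd, htd, rfl⟩ := h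
  have hl2 : IsSumSq ((1 + X : Polynomial ℝ) ^ 2) := by rw [sq]; exact IsSumSq.mul_self _
  exact ⟨(1 + X) ^ 2 * t, s, hl2.mul ht, hs, natDegree_sq_mul_le natDegree_one_add_X htd, hsd,
    by simp, by ring⟩

theorem EvenRep.natDegree_sq_mul_snd_le {k : ℕ} {t l : Polynomial ℝ} (hl : l.natDegree ≤ 1)
    (htd : t.natDegree ≤ 2 * k - 2) (h0 : k = 0 → t = 0) : (l ^ 2 * t).natDegree ≤ 2 * k := by
  rcases Nat.eq_zero_or_pos k with rfl | hk
  · simp [h0 rfl]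
  · refine (natDegree_sq_mul_le hl htd).trans (by omega)

theorem EvenRep.one_sub_X_mul {k : ℕ} {q : Polynomial ℝ} (h : EvenRep k q) :
    OddRep k ((1 - X) * q) := by
  obtain ⟨s, t, hs, ht, hsd, htd, h0, rfl⟩ := h
  have hl2 : IsSumSq ((1 - X : Polynomial ℝ) ^ 2) := by rw [sq]; exact IsSumSq.mul_self _
  exact ⟨s, (1 - X) ^ 2 * t, hs, hl2.mul ht, hsd,
    natDegree_sq_mul_snd_le natDegree_one_sub_X htd h0, by ring⟩

theorem EvenRep.one_add_X_mul {k : ℕ} {q : Polynomial ℝ} (h : EvenRep k q) :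
    OddRep k ((1 + X) * q) := by
  obtain ⟨s, t, hs, ht, hsd, htd, h0, rfl⟩ := h
  have hl2 : IsSumSq ((1 + X : Polynomial ℝ) ^ 2) := by rw [sq]; exact IsSumSq.mul_self _
  exact ⟨(1 + X) ^ 2 * t, s, hl2.mul ht, hs,
    natDegree_sq_mul_snd_le natDegree_one_add_X htd h0, hsd, by ring⟩

/-- Simultaneous induction over both parities. After subtracting the minimum, an endpoint factor
lowers the degree by one and changes parity, while an interior square lowers it by two and keeps
parity. -/
theorem evenRep_and_oddRep_of_nonneg_Icc (k : ℕ) :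
    (∀ q : Polynomial ℝ, q.natDegree ≤ 2 * k → (∀ x ∈ Set.Icc (-1 : ℝ) 1, 0 ≤ q.eval x) →
      EvenRep k q) ∧
    (∀ q : Polynomial ℝ, q.natDegree ≤ 2 * k + 1 → (∀ x ∈ Set.Icc (-1 : ℝ) 1, 0 ≤ q.eval x) →
      OddRep k q) := by
  have hodd : ∀ k : ℕ, (∀ q : Polynomial ℝ, q.natDegree ≤ 2 * k →
      (∀ x ∈ Set.Icc (-1 : ℝ) 1, 0 ≤ q.eval x) → EvenRep k q) →
      (∀ r : Polynomial ℝ, (2 * k = 0 → r = 0) → r.natDegree ≤ 2 * k - 1 →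
        (∀ x ∈ Set.Icc (-1 : ℝ) 1, 0 ≤ r.eval x) → ∀ a : ℝ, OddRep k ((X - C a) ^ 2 * r)) →
      ∀ q : Polynomial ℝ, q.natDegree ≤ 2 * k + 1 → (∀ x ∈ Set.Icc (-1 : ℝ) 1, 0 ≤ q.eval x) →
      OddRep k q := by
    intro k he ho q hd hq
    obtain ⟨c, hc, r, hr, ⟨hrd, rfl | rfl⟩ | ⟨h0, hrd, a, rfl⟩⟩ :=
      exists_cofactor_of_nonneg_Icc hd hq
    · exact (he r hrd hr).one_sub_X_mul.C_add hc
    · exact (he r hrd hr).one_add_X_mul.C_add hc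
    · exact (ho r h0 hrd hr a).C_add hc
  induction k with
  | zero =>
    have he : ∀ q : Polynomial ℝ, q.natDegree ≤ 2 * 0 →
        (∀ x ∈ Set.Icc (-1 : ℝ) 1, 0 ≤ q.eval x) → EvenRep 0 q := by
      intro q hd hq
      obtain ⟨c, rfl⟩ := natDegree_eq_zero.1 (Nat.le_zero.1 hd)
      have hc : 0 ≤ c := by simpa using hq 0 (by norm_num)
      exact ⟨C c, 0, IsSumSq.algebraMap_of_nonneg hc, IsSumSq.zero, by simp, by simp, by simp,
        by simp⟩
    refine ⟨he, hodd 0 he fun r h0 _ _ a => ?_⟩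
    rw [h0 rfl, mul_zero]
    exact ⟨0, 0, IsSumSq.zero, IsSumSq.zero, by simp, by simp, by simp⟩
  | succ k ih =>
    have he : ∀ q : Polynomial ℝ, q.natDegree ≤ 2 * (k + 1) →
        (∀ x ∈ Set.Icc (-1 : ℝ) 1, 0 ≤ q.eval x) → EvenRep (k + 1) q := by
      intro q hd hq
      obtain ⟨c, hc, r, hr, ⟨hrd, rfl | rfl⟩ | ⟨h0, hrd, a, rfl⟩⟩ :=
        exists_cofactor_of_nonneg_Icc (d := 2 * k + 1) hd hq
      · exact (ih.2 r hrd hr).one_sub_X_mul.C_add hc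
      · exact (ih.2 r hrd hr).one_add_X_mul.C_add hc
      · exact ((ih.1 r hrd hr).sq_mul (natDegree_X_sub_C a).le).C_add hc
    refine ⟨he, hodd (k + 1) he fun r h0 hrd hr a => ?_⟩
    exact (ih.2 r hrd hr).sq_mul (natDegree_X_sub_C a).le

end Polynomial

theorem totalDegree_aeval_X_le {σ : Type*} (i : σ) (q : Polynomial ℝ) :
    (Polynomial.aeval (X i : MvPolynomial σ ℝ) q).totalDegree ≤ q.natDegree := by
  rw [Polynomial.aeval_eq_sum_range]
  refine totalDegree_finsetSum_le fun j hj => ?_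
  refine (totalDegree_smul_le _ _).trans ?_
  rw [totalDegree_X_pow]
  exact Nat.lt_succ_iff.1 (Finset.mem_range.1 hj)

/-- A polynomial in one variable, nonnegative on `[-1, 1]` and of degree at most `2 k`, has the form
`θ₀ + θ₁ (1 - X²)` with sums of squares `θ₀`, `θ₁` and both terms of degree at most `2 k`. -/
theorem exists_isSumSq_of_nonneg_Icc {σ : Type*} [Unique σ] (i : σ) {k : ℕ} {h : MvPolynomial σ ℝ}
    (hd : h.totalDegree ≤ 2 * k) (hh : ∀ y : σ → ℝ, y i ∈ Set.Icc (-1) 1 → 0 ≤ eval y h) :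
    ∃ θ₀ θ₁ : MvPolynomial σ ℝ, IsSumSq θ₀ ∧ IsSumSq θ₁ ∧ θ₀.totalDegree ≤ 2 * k ∧
      (θ₁ * (1 - X i ^ 2)).totalDegree ≤ 2 * k ∧ h = θ₀ + θ₁ * (1 - X i ^ 2) := by
  set q : Polynomial ℝ := aeval (fun _ => Polynomial.X) h with hq
  have hback : Polynomial.aeval (X i) q = h := by
    rw [hq, ← AlgHom.comp_apply]
    refine (DFunLike.congr_fun (?_ : _ = AlgHom.id ℝ _) h)
    ext j
    simp [Subsingleton.elim j i]
  have hqd : q.natDegree ≤ 2 * k := by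
    simpa using MvPolynomial.aeval_natDegree_le h hd (fun _ => (Polynomial.X : Polynomial ℝ))
      (n := 1) (by simp)
  have hqe : ∀ x : ℝ, q.eval x = eval (fun _ => x) h := by
    intro x
    conv_rhs => rw [← hback]
    rw [Polynomial.aeval_def, Polynomial.hom_eval₂]
    simp [Polynomial.eval, Polynomial.eval₂_eq_sum_range]
  obtain ⟨s, t, hs, ht, hsd, htd, h0, hst⟩ :=
    (Polynomial.evenRep_and_oddRep_of_nonneg_Icc k).1 q hqd fun x hx => by
      rw [hqe]; exact hh _ hx
  let F := Polynomial.aeval (R := ℝ) (X i : MvPolynomial σ ℝ)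
  refine ⟨F s, F t, hs.map_ringHom F.toRingHom, ht.map_ringHom F.toRingHom,
    (totalDegree_aeval_X_le i s).trans hsd, ?_, ?_⟩
  · have h2 : F t * (1 - X i ^ 2) = F (t * (1 - Polynomial.X ^ 2)) := by simp [F]
    rw [h2]
    refine (totalDegree_aeval_X_le i _).trans ?_
    rcases Nat.eq_zero_or_pos k with rfl | hk
    · simp [h0 rfl]
    have h3 : (1 - Polynomial.X ^ 2 : Polynomial ℝ).natDegree ≤ 2 :=
      (Polynomial.natDegree_sub_le _ _).trans (by simp)
    refine Polynomial.natDegree_mul_le.trans (by omega)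
  · rw [← hback, hst]
    simp [F]

noncomputable section

/-! ### The S-lemma for quadratic polynomials -/

section Homogeneous

variable {ι : Type*} [Fintype ι]

/-- The quadratic form of a square matrix. -/
def quadForm (M : Matrix ι ι ℝ) (z : ι → ℝ) : ℝ := z ⬝ᵥ M.mulVec z

theorem quadForm_add_smul (M : Matrix ι ι ℝ) (z w : ι → ℝ) (s : ℝ) :
    quadForm M (z + s • w)
      = quadForm M z + s * (z ⬝ᵥ M.mulVec w + w ⬝ᵥ M.mulVec z) + s ^ 2 * quadForm M w := by
  simp only [quadForm, Matrix.mulVec_add, Matrix.mulVec_smul, add_dotProduct, dotProduct_add,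
    smul_dotProduct, dotProduct_smul, smul_eq_mul]
  ring

theorem quadForm_smul (M : Matrix ι ι ℝ) (c : ℝ) (z : ι → ℝ) :
    quadForm M (c • z) = c ^ 2 * quadForm M z := by
  simp only [quadForm, Matrix.mulVec_smul, dotProduct_smul, smul_dotProduct, smul_eq_mul]
  ring

theorem quadForm_sub_smul (M N : Matrix ι ι ℝ) (c : ℝ) (z : ι → ℝ) :
    quadForm (M - c • N) z = quadForm M z - c * quadForm N z := by
  simp only [quadForm, Matrix.sub_mulVec, Matrix.smul_mulVec, dotProduct_sub, dotProduct_smul,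
    smul_eq_mul]

theorem quadForm_continuous (M : Matrix ι ι ℝ) : Continuous (quadForm M) := by
  unfold quadForm
  exact continuous_id.dotProduct (Continuous.matrix_mulVec continuous_const continuous_id)

/-- A real quadratic `a + b s + c s²` with `a < 0 < c` has a negative and a positive root, with
product `a / c`. -/
theorem exists_roots_of_neg_of_pos {a b c : ℝ} (ha : a < 0) (hc : 0 < c) :
    ∃ s t : ℝ, 0 < s ∧ 0 < t ∧ a + s * b + s ^ 2 * c = 0 ∧ a + (-t) * b + (-t) ^ 2 * c = 0 ∧
      c * (s * t) = -a := by
  have hD : 0 < b ^ 2 - 4 * a * c := by nlinarith [sq_nonneg b, mul_pos (neg_pos.2 ha) hc]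
  set D := Real.sqrt (b ^ 2 - 4 * a * c) with hDdef
  have hD2 : D ^ 2 = b ^ 2 - 4 * a * c := Real.sq_sqrt hD.le
  have hlt : |b| < D := by
    apply Real.lt_sqrt_of_sq_lt
    rw [sq_abs]
    nlinarith [mul_pos (neg_pos.2 ha) hc]
  have hb := abs_lt.1 hlt
  refine ⟨(-b + D) / (2 * c), (b + D) / (2 * c), div_pos (by linarith) (by linarith),
    div_pos (by linarith) (by linarith), ?_, ?_, ?_⟩
  · field_simp
    linear_combination hD2
  · field_simp
    linear_combination hD2
  · field_simp
    linear_combination hD2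

/-- On the line `z + r w` the form `N` has roots `s > 0` and `-t < 0`, where `M` must be
nonnegative. Weighting these two inequalities by `t` and `s` cancels the cross term and leaves `M(z)
+ s t M(w) ≥ 0`, with `s t = -N(z)/N(w)`. -/
theorem quadForm_mul_le_of_nonneg {M N : Matrix ι ι ℝ}
    (h : ∀ z, 0 ≤ quadForm N z → 0 ≤ quadForm M z) {z w : ι → ℝ} (hz : quadForm N z < 0)
    (hw : 0 < quadForm N w) : quadForm M w * quadForm N z ≤ quadForm M z * quadForm N w := by
  obtain ⟨s, t, hs, ht, h1, h2, h3⟩ := exists_roots_of_neg_of_pos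
    (b := z ⬝ᵥ N.mulVec w + w ⬝ᵥ N.mulVec z) hz hw
  have e1 := h (z + s • w) (by rw [quadForm_add_smul, h1])
  have e2 := h (z + (-t) • w) (by rw [quadForm_add_smul, h2])
  rw [quadForm_add_smul] at e1 e2
  set B := z ⬝ᵥ M.mulVec w + w ⬝ᵥ M.mulVec z
  have e3 : 0 ≤ (s + t) * (quadForm M z + s * t * quadForm M w) := by
    nlinarith [mul_nonneg ht.le e1, mul_nonneg hs.le e2]
  have e4 : 0 ≤ quadForm M z + s * t * quadForm M w :=
    nonneg_of_mul_nonneg_right e3 (by linarith)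
  have e5 := mul_nonneg hw.le e4
  have e6 : quadForm N w * (quadForm M z + s * t * quadForm M w)
      = quadForm M z * quadForm N w - quadForm M w * quadForm N z := by
    linear_combination quadForm M w * h3
  linarith

/-- The homogeneous S-lemma. -/
theorem exists_forall_quadForm_sub_nonneg {M N : Matrix ι ι ℝ}
    (h : ∀ z, 0 ≤ quadForm N z → 0 ≤ quadForm M z) (hN : ∃ w, 0 < quadForm N w) :
    ∃ c : ℝ, 0 ≤ c ∧ ∀ z, 0 ≤ quadForm M z - c * quadForm N z := by
  obtain ⟨w₀, hw₀⟩ := hN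
  -- The multiplier is the infimum of `M/N` over `N > 0`; the preceding inequality puts every ratio
  -- with `N < 0` below it.
  let T : Set ℝ := (fun w => quadForm M w / quadForm N w) '' {w | 0 < quadForm N w}
  have hT0 : ∀ r ∈ T, 0 ≤ r := by
    rintro _ ⟨w, hw, rfl⟩
    exact div_nonneg (h w (le_of_lt hw)) (le_of_lt hw)
  have hTne : T.Nonempty := ⟨_, w₀, hw₀, rfl⟩
  refine ⟨sInf T, le_csInf hTne hT0, fun z => ?_⟩
  rcases lt_trichotomy (quadForm N z) 0 with hz | hz | hz
  · have : quadForm M z / quadForm N z ≤ sInf T := by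
      refine le_csInf hTne ?_
      rintro _ ⟨w, hw, rfl⟩
      have hw' : 0 < quadForm N w := hw
      rw [le_div_iff₀ hw', div_mul_eq_mul_div, div_le_iff_of_neg hz]
      exact quadForm_mul_le_of_nonneg h hz hw
    rw [div_le_iff_of_neg hz] at this
    linarith
  · rw [hz, mul_zero, sub_zero]
    exact h z hz.ge
  · have : sInf T ≤ quadForm M z / quadForm N z := csInf_le ⟨0, hT0⟩ ⟨z, hz, rfl⟩
    rw [le_div_iff₀ hz] at this
    linarith

end Homogeneous

variable {n : ℕ}

/-- The vector `(1, X₁, …, Xₙ)`. -/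
def affineVars (n : ℕ) : Option (Fin n) → MvPolynomial (Fin n) ℝ := fun o => o.elim 1 X

/-- The point `(1, y)`. -/
def affinePoint (y : Fin n → ℝ) : Option (Fin n) → ℝ := fun o => o.elim 1 y

/-- The polynomial `vᵀ M v` with `v = (1, X₁, …, Xₙ)`. -/
def quadPoly (M : Matrix (Option (Fin n)) (Option (Fin n)) ℝ) : MvPolynomial (Fin n) ℝ :=
  ∑ i, ∑ j, M i j • (affineVars n i * affineVars n j)

theorem quadPoly_add (M N : Matrix (Option (Fin n)) (Option (Fin n)) ℝ) :
    quadPoly (M + N) = quadPoly M + quadPoly N := by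
  simp only [quadPoly, Matrix.add_apply, add_smul, Finset.sum_add_distrib]

theorem quadPoly_smul (c : ℝ) (M : Matrix (Option (Fin n)) (Option (Fin n)) ℝ) :
    quadPoly (c • M) = c • quadPoly M := by
  simp only [quadPoly, Matrix.smul_apply, smul_assoc, Finset.smul_sum]

theorem quadPoly_transpose (M : Matrix (Option (Fin n)) (Option (Fin n)) ℝ) :
    quadPoly M.transpose = quadPoly M := by
  rw [quadPoly, Finset.sum_comm]
  simp only [Matrix.transpose_apply, quadPoly, mul_comm]

theorem quadPoly_single (i j : Option (Fin n)) :
    quadPoly (Matrix.single i j 1) = affineVars n i * affineVars n j := by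
  classical
  simp [quadPoly, Matrix.single_apply, ite_and]

theorem eval_quadPoly (M : Matrix (Option (Fin n)) (Option (Fin n)) ℝ) (y : Fin n → ℝ) :
    eval y (quadPoly M) = quadForm M (affinePoint y) := by
  have h : ∀ o, eval y (affineVars n o) = affinePoint y o := by
    rintro (_ | i) <;> simp [affineVars, affinePoint]
  simp only [quadPoly, map_sum, smul_eval, map_mul, h, quadForm, dotProduct, Matrix.mulVec,
    Finset.mul_sum]
  exact Finset.sum_congr rfl fun i _ => Finset.sum_congr rfl fun j _ => by ring

theorem totalDegree_quadPoly_le (M : Matrix (Option (Fin n)) (Option (Fin n)) ℝ) :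
    (quadPoly M).totalDegree ≤ 2 := by
  have h : ∀ o, (affineVars n o).totalDegree ≤ 1 := by
    rintro (_ | i) <;> simp [affineVars]
  refine totalDegree_finsetSum_le fun i _ => totalDegree_finsetSum_le fun j _ => ?_
  refine (totalDegree_smul_le _ _).trans ((totalDegree_mul _ _).trans ?_)
  have := h i
  have := h j
  omega

theorem exists_monomial_eq_affineVars_mul {α : Fin n →₀ ℕ} (hα : α.degree ≤ 2) :
    ∃ i j, monomial α (1 : ℝ) = affineVars n i * affineVars n j := by
  classical
  by_cases h0 : α = 0
  · exact ⟨none, none, by simp [h0, affineVars]⟩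
  obtain ⟨i, hi⟩ : ∃ i, α i ≠ 0 := by
    by_contra! hc
    exact h0 (Finsupp.ext hc)
  obtain ⟨β, rfl⟩ : ∃ β, α = Finsupp.single i 1 + β :=
    ⟨α - Finsupp.single i 1, (add_tsub_cancel_of_le (by
      rw [Finsupp.single_le_iff]; omega)).symm⟩
  rw [map_add, Finsupp.degree_single] at hα
  by_cases h1 : β = 0
  · exact ⟨some i, none, by simp [h1, affineVars, X]⟩
  obtain ⟨j, hj⟩ : ∃ j, β j ≠ 0 := by
    by_contra! hc
    exact h1 (Finsupp.ext hc)
  obtain ⟨δ, rfl⟩ : ∃ δ, β = Finsupp.single j 1 + δ :=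
    ⟨β - Finsupp.single j 1, (add_tsub_cancel_of_le (by
      rw [Finsupp.single_le_iff]; omega)).symm⟩
  rw [map_add, Finsupp.degree_single] at hα
  have hδ : δ = 0 := by
    rw [← Finsupp.degree_eq_zero_iff]; omega
  exact ⟨some i, some j, by simp [hδ, affineVars, X, monomial_mul]⟩

theorem exists_isSymm_quadPoly_eq {q : MvPolynomial (Fin n) ℝ} (hq : q.totalDegree ≤ 2) :
    ∃ M : Matrix (Option (Fin n)) (Option (Fin n)) ℝ, M.IsSymm ∧ quadPoly M = q := by
  classical
  obtain ⟨M, hM⟩ : ∃ M : Matrix (Option (Fin n)) (Option (Fin n)) ℝ, quadPoly M = q := by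
    let F : Matrix (Option (Fin n)) (Option (Fin n)) ℝ →ₗ[ℝ] MvPolynomial (Fin n) ℝ :=
      { toFun := quadPoly, map_add' := quadPoly_add, map_smul' := quadPoly_smul }
    change q ∈ LinearMap.range F
    rw [q.as_sum]
    refine Submodule.sum_mem _ fun α hα => ?_
    obtain ⟨i, j, hij⟩ := exists_monomial_eq_affineVars_mul
      (α := α) ((le_totalDegree hα).trans hq)
    have : monomial α (coeff α q) = coeff α q • monomial α (1 : ℝ) := by
      rw [smul_monomial, smul_eq_mul, mul_one]
    rw [this, hij]
    exact Submodule.smul_mem _ _ ⟨Matrix.single i j 1, quadPoly_single i j⟩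
  refine ⟨(1 / 2 : ℝ) • (M + M.transpose), ?_, ?_⟩
  · simp [Matrix.IsSymm, Matrix.transpose_add, add_comm]
  · rw [quadPoly_smul, quadPoly_add, quadPoly_transpose, hM, ← two_smul ℝ q, smul_smul]
    norm_num

/-- If a quadratic polynomial is nonnegative where `φ` is, then so are their homogenizations. -/
theorem quadForm_nonneg_of_eval_nonneg {M N : Matrix (Option (Fin n)) (Option (Fin n)) ℝ}
    (h : ∀ y, 0 ≤ quadForm N (affinePoint y) → 0 ≤ quadForm M (affinePoint y))
    (hN : ∃ y : Fin n → ℝ, 0 < quadForm N (affinePoint y)) (z : Option (Fin n) → ℝ)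
    (hz : 0 ≤ quadForm N z) : 0 ≤ quadForm M z := by
  obtain ⟨y₀, hy₀⟩ := hN
  -- Off the hyperplane at infinity, `z` is a multiple of an affine point. At infinity it is the
  -- limit of `t⁻¹(1, y₀) + z` as `t → ∞`.
  by_cases h0 : z none = 0
  · have key : ∀ v : Fin n → ℝ, ∀ w : Option (Fin n) → ℝ, (∀ o, w o = o.elim 0 v) →
        0 ≤ quadForm N w →
        0 ≤ affinePoint y₀ ⬝ᵥ N.mulVec w + w ⬝ᵥ N.mulVec (affinePoint y₀) →
        0 ≤ quadForm M w := by
      intro v w hw hNw hB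
      have hpt : ∀ t : ℝ, affinePoint y₀ + t • w = affinePoint (y₀ + t • v) := by
        intro t
        ext o
        rcases o with _ | i <;> simp [affinePoint, hw]
      have hnn : ∀ t : ℝ, 0 ≤ t → 0 ≤ quadForm M (affinePoint y₀ + t • w) := by
        intro t ht
        rw [hpt]
        refine h _ ?_
        rw [← hpt, quadForm_add_smul]
        have := mul_nonneg ht hB
        have := mul_nonneg (sq_nonneg t) hNw
        linarith
      have hlim : Filter.Tendsto (fun t : ℝ => quadForm M (t⁻¹ • affinePoint y₀ + w))
          Filter.atTop (nhds (quadForm M w)) := by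
        have h1 : Filter.Tendsto (fun t : ℝ => t⁻¹ • affinePoint y₀ + w) Filter.atTop
            (nhds ((0 : ℝ) • affinePoint y₀ + w)) :=
          (tendsto_inv_atTop_zero.smul_const _).add_const _
        rw [zero_smul, zero_add] at h1
        exact ((quadForm_continuous M).tendsto w).comp h1
      refine ge_of_tendsto hlim ?_
      filter_upwards [Filter.eventually_gt_atTop 0] with t ht
      have : t⁻¹ • affinePoint y₀ + w = t⁻¹ • (affinePoint y₀ + t • w) := by
        rw [smul_add, smul_smul, inv_mul_cancel₀ ht.ne', one_smul]
      rw [this, quadForm_smul]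
      exact mul_nonneg (sq_nonneg _) (hnn t ht.le)
    have hneg : ∀ K : Matrix (Option (Fin n)) (Option (Fin n)) ℝ,
        quadForm K (-z) = quadForm K z := by
      intro K
      simpa using quadForm_smul K (-1) z
    -- Forms are even, so the sign of `z` may be chosen to make the cross term nonnegative; then `N
    -- ≥ 0` along the whole ray from `y₀`.
    rcases le_total 0 (affinePoint y₀ ⬝ᵥ N.mulVec z + z ⬝ᵥ N.mulVec (affinePoint y₀)) with hB | hB
    · refine key (fun i => z (some i)) z ?_ hz hB
      rintro (_ | i) <;> simp [h0]
    · rw [← hneg]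
      refine key (fun i => -z (some i)) (-z) ?_ (by rwa [hneg]) ?_
      · rintro (_ | i) <;> simp [h0]
      · rw [Matrix.mulVec_neg, dotProduct_neg, neg_dotProduct]
        linarith
  · have hpt : z = z none • affinePoint fun i => (z none)⁻¹ * z (some i) := by
      ext o
      rcases o with _ | i <;> simp [affinePoint, h0]
    have hpos : 0 < z none ^ 2 := by positivity
    rw [hpt, quadForm_smul] at hz ⊢
    exact mul_nonneg hpos.le (h _ (nonneg_of_mul_nonneg_right hz hpos))

/-- The S-lemma in polynomial form. -/
theorem exists_isSumSq_add_smul_of_nonneg {q φ : MvPolynomial (Fin n) ℝ} (hq : q.totalDegree ≤ 2)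
    (hφ : φ.totalDegree ≤ 2) (hpos : ∃ y, 0 < eval y φ)
    (h : ∀ y, 0 ≤ eval y φ → 0 ≤ eval y q) :
    ∃ (θ : MvPolynomial (Fin n) ℝ) (c : ℝ), IsSumSq θ ∧ θ.totalDegree ≤ 2 ∧ 0 ≤ c ∧
      q = θ + c • φ := by
  obtain ⟨M, hMs, rfl⟩ := exists_isSymm_quadPoly_eq hq
  obtain ⟨N, hNs, rfl⟩ := exists_isSymm_quadPoly_eq hφ
  simp only [eval_quadPoly] at hpos h
  obtain ⟨c, hc, hcz⟩ := exists_forall_quadForm_sub_nonneg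
    (quadForm_nonneg_of_eval_nonneg h hpos) (hpos.imp' affinePoint fun _ hy => hy)
  have hps : (M - c • N).PosSemidef := by
    refine Matrix.PosSemidef.of_dotProduct_mulVec_nonneg ?_ fun z => ?_
    · rw [Matrix.IsHermitian, Matrix.conjTranspose_eq_transpose_of_trivial, Matrix.transpose_sub,
        Matrix.transpose_smul, hMs.eq, hNs.eq]
    · rw [star_trivial]
      have := hcz z
      rwa [← quadForm_sub_smul] at this
  refine ⟨quadPoly (M - c • N), c, isSumSq_of_posSemidef hps _, totalDegree_quadPoly_le _, hc, ?_⟩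
  rw [← quadPoly_smul, ← quadPoly_add, sub_add_cancel]

end

noncomputable section

/-! ### Functionals applied to one group of variables -/

theorem totalDegree_map_le_totalDegree {σ A B : Type*} [CommRing A] [CommRing B] (F : A →+* B)
    (q : MvPolynomial σ A) : (map F q).totalDegree ≤ q.totalDegree :=
  Finset.sup_mono (support_map_subset F q)

theorem eval_applyFunctional {σ τ : Type*} (L : MvPolynomial σ ℝ →ₗ[ℝ] ℝ)
    (q : MvPolynomial σ (MvPolynomial τ ℝ)) (y : τ → ℝ) :
    eval y (applyFunctional L q) = L (map (eval y) q) := by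
  conv_rhs => rw [q.as_sum, map_sum, map_sum]
  rw [applyFunctional, map_sum]
  refine Finset.sum_congr rfl fun α _ => ?_
  rw [map_monomial, smul_eval, ← mul_one (eval y (coeff α q)), ← smul_eq_mul _ (1 : ℝ),
    ← smul_monomial, map_smul, smul_eq_mul, smul_eq_mul, mul_one, mul_comm]

theorem map_eval_sumAlgEquiv {σ τ : Type*} (q : MvPolynomial (σ ⊕ τ) ℝ) (y : τ → ℝ) :
    map (eval y) (sumAlgEquiv ℝ σ τ q) = aeval (Sum.elim X fun k => C (y k)) q := by
  induction q using MvPolynomial.induction_on with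
  | C a => simp [MvPolynomial.algebraMap_eq]
  | add p q hp hq => simp [hp, hq]
  | mul_X p j hp => rcases j with j | j <;> simp [hp]

theorem eval_aeval_sumElim {σ τ : Type*} (q : MvPolynomial (σ ⊕ τ) ℝ) (x : σ → ℝ) (y : τ → ℝ) :
    eval x (aeval (Sum.elim X fun k => C (y k)) q) = eval (Sum.elim x y) q := by
  induction q using MvPolynomial.induction_on with
  | C a => simp [MvPolynomial.algebraMap_eq]
  | add p q hp hq => rw [map_add, map_add, map_add, hp, hq]
  | mul_X p j hp =>
    rw [map_mul, map_mul, map_mul, hp]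
    rcases j with j | j <;> simp

namespace FSIPP

variable {m n s : ℕ} (P : FSIPP m n s)

theorem map_eval_pX (y : Fin n → ℝ) : map (eval y) P.pX = P.pAt y := map_eval_sumAlgEquiv _ _

theorem eval_pAt (x : Fin m → ℝ) (y : Fin n → ℝ) :
    eval x (P.pAt y) = eval (Sum.elim x y) P.p := eval_aeval_sumElim _ _ _

theorem eval_map_eval_pY (x : Fin m → ℝ) (y : Fin n → ℝ) :
    eval y (map (eval x) P.pY) = eval (Sum.elim x y) P.p := by
  rw [pY, map_eval_sumAlgEquiv, eval_aeval_sumElim, eval_rename]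
  congr 2
  ext o
  rcases o with i | i <;> rfl

theorem totalDegree_f_le : P.f.totalDegree ≤ P.d := by simp [d]

theorem totalDegree_g_le : P.g.totalDegree ≤ P.d := by simp [d]

theorem totalDegree_ψ_le (j : Fin s) : (P.ψ j).totalDegree ≤ P.d := by
  have h := Finset.le_sup (f := fun j => (P.ψ j).totalDegree) (Finset.mem_univ j)
  exact h.trans ((le_max_left _ _).trans (le_max_right _ _))

theorem totalDegree_pAt_le (y : Fin n → ℝ) : (P.pAt y).totalDegree ≤ P.d := by
  rw [← map_eval_pX]
  exact (totalDegree_map_le_totalDegree _ _).trans ((le_max_right _ _).trans (le_max_right _ _))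

theorem zero_mem_coneX : (0 : MvPolynomial (Fin m) ℝ) ∈ P.coneX := ⟨IsSumSq.zero, by simp⟩

theorem add_mem_coneX {h k : MvPolynomial (Fin m) ℝ} (hh : h ∈ P.coneX) (hk : k ∈ P.coneX) :
    h + k ∈ P.coneX :=
  ⟨hh.1.add hk.1, (totalDegree_add _ _).trans (max_le hh.2 hk.2)⟩

theorem smul_mem_coneX {c : ℝ} (hc : 0 ≤ c) {h : MvPolynomial (Fin m) ℝ} (hh : h ∈ P.coneX) :
    c • h ∈ P.coneX :=
  ⟨hh.1.smul_of_nonneg hc, (totalDegree_smul_le _ _).trans hh.2⟩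

theorem sum_mem_coneX {ι : Type*} (t : Finset ι) {h : ι → MvPolynomial (Fin m) ℝ}
    (hh : ∀ i ∈ t, h i ∈ P.coneX) : ∑ i ∈ t, h i ∈ P.coneX :=
  ⟨IsSumSq.sum fun i hi => (hh i hi).1, totalDegree_finsetSum_le fun i hi => (hh i hi).2⟩

theorem firstOrderRemainder_mem_coneX {h : MvPolynomial (Fin m) ℝ} (hh : SOSConvex h)
    (hd : h.totalDegree ≤ P.d) (a : Fin m → ℝ) : firstOrderRemainder a h ∈ P.coneX :=
  ⟨hh.isSumSq_firstOrderRemainder a, (totalDegree_firstOrderRemainder_le a h).trans (by omega)⟩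

/-! ### Dual functionals, Jensen's inequality and weak duality. -/

variable {P} {Cy : Set (MvPolynomial (Fin n) ℝ)}

/-- Jensen's inequality for s.o.s-convex polynomials and functionals nonnegative on squares. -/
theorem apply_one_mul_eval_le {L : MvPolynomial (Fin m) ℝ →ₗ[ℝ] ℝ} (hL : L ∈ dualCone P.coneX)
    (h1 : 0 < L 1) {h : MvPolynomial (Fin m) ℝ} (hh : SOSConvex h) (hd : h.totalDegree ≤ P.d) :
    L 1 * eval (fun i => L (X i) / L 1) h ≤ L h := by
  set a : Fin m → ℝ := fun i => L (X i) / L 1 with ha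
  have hC : ∀ c : ℝ, L (C c) = c * L 1 := by
    intro c
    rw [← mul_one (C c), ← smul_eq_C_mul, map_smul, smul_eq_mul]
  have h0 := hL _ (P.firstOrderRemainder_mem_coneX hh hd a)
  have hsum : ∑ i, L (C (eval a (pderiv i h)) * (X i - C (a i))) = 0 := by
    refine Finset.sum_eq_zero fun i _ => ?_
    rw [← smul_eq_C_mul, map_smul, map_sub, hC, ha]
    simp only
    rw [div_mul_cancel₀ _ h1.ne', sub_self, smul_zero]
  rw [firstOrderRemainder_apply, map_sub, map_sub, map_sum, hsum, hC] at h0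
  linarith

/-- If `L 1 = 0`, then `L((g - t)²) = L(g²) - 2t` because `L g = 1`, and this is negative for large
`t`. The square has degree at most `2d`, so it lies in the cone. -/
theorem DualFeasible.apply_one_pos {L : MvPolynomial (Fin m) ℝ →ₗ[ℝ] ℝ}
    (hL : P.DualFeasible P.coneX Cy L) : 0 < L 1 := by
  have h1 : 0 ≤ L 1 := hL.1 1 ⟨IsSumSq.one, by simp⟩
  refine lt_of_le_of_ne h1 fun h0 => ?_
  have key : ∀ t : ℝ, 0 ≤ L (P.g * P.g) - 2 * t := by
    intro t
    have hmem : (P.g - C t) * (P.g - C t) ∈ P.coneX := by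
      refine ⟨IsSumSq.mul_self _, (totalDegree_mul _ _).trans ?_⟩
      have := totalDegree_sub P.g (C t)
      have := P.totalDegree_g_le
      simp only [totalDegree_C, Nat.zero_le, sup_of_le_left] at *
      omega
    have h2 := hL.1 _ hmem
    have hexp : (P.g - C t) * (P.g - C t) = P.g * P.g - (2 * t) • P.g + (t * t) • 1 := by
      simp only [smul_eq_C_mul, map_mul]
      have : (C 2 : MvPolynomial (Fin m) ℝ) = 2 := map_ofNat C 2
      rw [this]
      ring
    rw [hexp, map_add, map_sub, map_smul, map_smul, ← h0, hL.2.1] at h2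
    simpa using h2
  have := key (L (P.g * P.g) / 2 + 1)
  linarith

/-- The point represented by a feasible functional is feasible, and does not increase the
objective. -/
theorem DualFeasible.point_mem_K (hdata : P.SOSConvexData) (hA2 : P.A2)
    (hpos : ∀ h ∈ Cy, ∀ y ∈ P.Y, 0 ≤ eval y h) {L : MvPolynomial (Fin m) ℝ →ₗ[ℝ] ℝ}
    (hL : P.DualFeasible P.coneX Cy L) :
    (fun i => L (X i) / L 1) ∈ P.K ∧ P.obj (fun i => L (X i) / L 1) ≤ L P.f := by
  have h1 := hL.apply_one_pos
  obtain ⟨hf, hg, hψ, hp⟩ := hdata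
  have hJ : ∀ {h : MvPolynomial (Fin m) ℝ}, SOSConvex h → h.totalDegree ≤ P.d →
      L 1 * eval (fun i => L (X i) / L 1) h ≤ L h := apply_one_mul_eval_le hL.1 h1
  set a : Fin m → ℝ := fun i => L (X i) / L 1
  have hK : a ∈ P.K := by
    refine ⟨fun j => ?_, fun y hy => ?_⟩
    · have := (hJ (hψ j) (P.totalDegree_ψ_le j)).trans (hL.2.2.2 j)
      exact nonpos_of_mul_nonpos_right this h1
    · have h2 := hpos _ hL.2.2.1 y hy
      rw [map_neg, eval_applyFunctional, map_eval_pX] at h2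
      have h3 := hJ (hp y hy) (P.totalDegree_pAt_le y)
      rw [eval_pAt] at h3
      exact nonpos_of_mul_nonpos_right (h3.trans (by linarith)) h1
  refine ⟨hK, ?_⟩
  have hfJ := hJ hf P.totalDegree_f_le
  have hgJ := hJ hg (by rw [totalDegree_neg]; exact P.totalDegree_g_le)
  rw [map_neg, map_neg, hL.2.1] at hgJ
  -- Jensen for `-g` gives `L(1) g(a) ≥ 1`, which suffices when `f(a) ≥ 0`. For affine `g` Jensen
  -- holds both ways, so `L(1) g(a) = 1` and the sign of `f` is irrelevant.
  rcases hA2 with hA | ⟨hdeg, hA⟩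
  · obtain ⟨hf0, hg0⟩ := hA a hK
    rw [obj, div_le_iff₀ hg0]
    have h2 : 0 ≤ L P.f := (mul_nonneg h1.le hf0).trans hfJ
    nlinarith
  · have hg0 := hA a hK
    have hgJ' := hJ (sosConvex_of_totalDegree_le_one hdeg) P.totalDegree_g_le
    rw [hL.2.1] at hgJ'
    rw [obj, div_le_iff₀ hg0]
    have h2 : L 1 * eval a P.g = 1 := by linarith
    have h3 := mul_le_mul_of_nonneg_right hfJ hg0.le
    have h4 : L 1 * eval a P.f * eval a P.g = eval a P.f := by linear_combination eval a P.f * h2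
    linarith

/-- Normalized evaluation at a feasible point is feasible for the dual problem. -/
theorem exists_dualFeasible_of_mem_K
    (hmem : ∀ h : MvPolynomial (Fin n) ℝ, h.totalDegree ≤ P.dy → (∀ y ∈ P.Y, 0 ≤ eval y h) → h ∈ Cy)
    {x : Fin m → ℝ} (hx : x ∈ P.K) (hg : 0 < eval x P.g) :
    ∃ L, P.DualFeasible P.coneX Cy L ∧ L P.f = P.obj x := by
  let L : MvPolynomial (Fin m) ℝ →ₗ[ℝ] ℝ := (eval x P.g)⁻¹ • (aeval x).toLinearMap
  have hL : ∀ h, L h = (eval x P.g)⁻¹ * eval x h := fun h => by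
    simp [L, aeval_eq_eval]
  have hinv : 0 ≤ (eval x P.g)⁻¹ := inv_nonneg.2 hg.le
  refine ⟨L, ⟨fun h hh => ?_, ?_, ?_, fun j => ?_⟩, ?_⟩
  · rw [hL]
    exact mul_nonneg hinv (hh.1.eval_nonneg x)
  · rw [hL, inv_mul_cancel₀ hg.ne']
  · have heq : applyFunctional L P.pX = (eval x P.g)⁻¹ • map (eval x) P.pY := by
      refine MvPolynomial.funext fun y => ?_
      rw [eval_applyFunctional, map_eval_pX, hL, eval_pAt, smul_eval, eval_map_eval_pY]
    rw [heq]
    refine hmem _ ?_ fun y hy => ?_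
    · rw [totalDegree_neg]
      exact (totalDegree_smul_le _ _).trans (totalDegree_map_le_totalDegree _ _)
    · rw [map_neg, smul_eval, eval_map_eval_pY]
      have := mul_nonneg hinv (neg_nonneg.2 (hx.2 y hy))
      linarith
  · rw [hL]
    have := mul_nonneg hinv (neg_nonneg.2 (hx.1 j))
    linarith
  · rw [hL, obj, div_eq_inv_mul]

theorem rStar_eq_obj {x : Fin m → ℝ} (hx : x ∈ P.S) : P.rStar = P.obj x :=
  IsLeast.csInf_eq ⟨⟨x, hx.1, rfl⟩, by rintro _ ⟨z, hz, rfl⟩; exact hx.2 z hz⟩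

theorem A2.g_pos (hA2 : P.A2) {x : Fin m → ℝ} (hx : x ∈ P.K) : 0 < eval x P.g := by
  rcases hA2 with h | h
  · exact (h x hx).2
  · exact h.2 x hx

/-- Exactness of the dual problem. -/
theorem dual_exact (hdata : P.SOSConvexData) (hA2 : P.A2) (hS : P.S.Nonempty)
    (hpos : ∀ h ∈ Cy, ∀ y ∈ P.Y, 0 ≤ eval y h)
    (hmem : ∀ h : MvPolynomial (Fin n) ℝ, h.totalDegree ≤ P.dy → (∀ y ∈ P.Y, 0 ≤ eval y h) →
      h ∈ Cy) :
    P.rDual P.coneX Cy = (P.rStar : EReal) ∧ (∃ L, P.IsDualMinimizer P.coneX Cy L) ∧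
      ∀ L, P.IsDualMinimizer P.coneX Cy L →
        0 < L 1 ∧ (fun i => L (X i) / L 1) ∈ P.S := by
  obtain ⟨x, hx⟩ := hS
  have hr := rStar_eq_obj hx
  obtain ⟨L₀, hL₀, hL₀f⟩ := exists_dualFeasible_of_mem_K hmem hx.1 (hA2.g_pos hx.1)
  have hlow : ∀ L, P.DualFeasible P.coneX Cy L → P.obj x ≤ L P.f := by
    intro L hL
    obtain ⟨hK, hle⟩ := hL.point_mem_K hdata hA2 hpos
    exact (hx.2 _ hK).trans hle
  refine ⟨?_, ⟨L₀, hL₀, fun L hL => hL₀f.le.trans (hlow L hL)⟩, fun L hL => ?_⟩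
  · refine IsLeast.csInf_eq ⟨⟨L₀, hL₀, by rw [hL₀f, hr]⟩, ?_⟩
    rintro _ ⟨L, hL, rfl⟩
    rw [hr]
    exact EReal.coe_le_coe_iff.2 (hlow L hL)
  · obtain ⟨hK, hle⟩ := hL.1.point_mem_K hdata hA2 hpos
    refine ⟨hL.1.apply_one_pos, hK, fun z hz => ?_⟩
    exact (hle.trans ((hL.2 L₀ hL₀).trans hL₀f.le)).trans (hx.2 z hz)

/-- Weak duality for the primal problem. -/
theorem PrimalFeasible.le_obj
    (hmem : ∀ h : MvPolynomial (Fin n) ℝ, h.totalDegree ≤ P.dy → (∀ y ∈ P.Y, 0 ≤ eval y h) → h ∈ Cy)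
    {ρ : ℝ} {H : MvPolynomial (Fin n) ℝ →ₗ[ℝ] ℝ} {η : Fin s → ℝ}
    (h : P.PrimalFeasible P.coneX Cy ρ H η) {x : Fin m → ℝ} (hx : x ∈ P.K) (hg : 0 < eval x P.g) :
    ρ ≤ P.obj x := by
  obtain ⟨h1, hH, hη⟩ := h
  have h2 := h1.1.eval_nonneg x
  have h3 : H (map (eval x) P.pY) ≤ 0 := by
    have := hH (-map (eval x) P.pY) (hmem _
      (by rw [totalDegree_neg]; exact totalDegree_map_le_totalDegree _ _) fun y hy => by
        rw [map_neg, eval_map_eval_pY]; exact neg_nonneg.2 (hx.2 y hy))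
    rw [map_neg] at this
    linarith
  have h4 : ∑ j, η j * eval x (P.ψ j) ≤ 0 :=
    Finset.sum_nonpos fun j _ => mul_nonpos_of_nonneg_of_nonpos (hη j) (hx.1 j)
  simp only [map_add, map_sub, smul_eval, eval_applyFunctional, map_sum] at h2
  rw [obj, le_div_iff₀ hg]
  linarith

/-! ### Integration of the semi-infinite constraint -/

/-- Integration over `Y` as a functional on polynomials. -/
def integralFunctional (hY : IsCompact P.Y) (μ : Measure (Fin n → ℝ)) [IsFiniteMeasure μ] :
    MvPolynomial (Fin n) ℝ →ₗ[ℝ] ℝ where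
  toFun q := ∫ y in P.Y, eval y q ∂μ
  map_add' q r := by
    have hi : ∀ q : MvPolynomial (Fin n) ℝ, IntegrableOn (fun y => eval y q) P.Y μ := fun q =>
      (MvPolynomial.continuous_eval q).continuousOn.integrableOn_compact hY
    simp only [map_add]
    exact integral_add (hi q) (hi r)
  map_smul' c q := by
    simp only [smul_eval, RingHom.id_apply, smul_eq_mul]
    exact integral_const_mul c _

/-- The polynomial `∫_Y p(·, y) dμ(y)` has its first-order remainders in the cone of sums of
squares. It is a multiple of an element of the convex hull of the compact set
`{p(·, y) | y ∈ Y}`. -/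
theorem firstOrderRemainder_integral_mem_coneX (hp : ∀ y ∈ P.Y, SOSConvex (P.pAt y))
    (hY : IsCompact P.Y) (μ : Measure (Fin n → ℝ)) [IsFiniteMeasure μ] (a : Fin m → ℝ) :
    firstOrderRemainder a (applyFunctional (integralFunctional hY μ) P.pY) ∈ P.coneX := by
  -- Only finitely many monomials in `x` occur, so the `p(·, y)` are coded by vectors of a
  -- finite-dimensional space, where averages are defined.
  let toPoly : (P.pX.support → ℝ) →ₗ[ℝ] MvPolynomial (Fin m) ℝ :=
    { toFun := fun v => ∑ α : P.pX.support, monomial (α : Fin m →₀ ℕ) (v α)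
      map_add' := fun v w => by simp [Finset.sum_add_distrib]
      map_smul' := fun c v => by simp [Finset.smul_sum, smul_monomial] }
  let κ : (Fin n → ℝ) → P.pX.support → ℝ := fun y α => eval y (P.pX.coeff α)
  have hκ : Continuous κ := continuous_pi fun α => MvPolynomial.continuous_eval _
  have hκi : IntegrableOn κ P.Y μ := hκ.continuousOn.integrableOn_compact hY
  have htoPoly : ∀ y, toPoly (κ y) = P.pAt y := by
    intro y
    rw [← map_eval_pX]
    conv_rhs => rw [P.pX.as_sum, map_sum]
    simp only [map_monomial]
    exact Finset.sum_coe_sort P.pX.support fun α => monomial α (eval y (coeff α P.pX))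
  have hint : applyFunctional (integralFunctional hY μ) P.pY = toPoly (∫ y in P.Y, κ y ∂μ) := by
    refine MvPolynomial.funext fun x => ?_
    rw [eval_applyFunctional]
    let ev : (P.pX.support → ℝ) →ₗ[ℝ] ℝ := (aeval x).toLinearMap ∘ₗ toPoly
    have h1 := (LinearMap.toContinuousLinearMap ev).integral_comp_comm hκi
    have h2 : ∀ v, ev v = eval x (toPoly v) := fun v => by simp [ev, aeval_eq_eval]
    simp only [LinearMap.coe_toContinuousLinearMap', h2, htoPoly, eval_pAt] at h1
    rw [← h1]
    change ∫ y in P.Y, eval y (map (eval x) P.pY) ∂μ = _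
    simp only [eval_map_eval_pY]
  rw [hint]
  by_cases h0 : μ P.Y = 0
  · rw [Measure.restrict_eq_zero.2 h0, integral_zero_measure, map_zero, map_zero]
    exact P.zero_mem_coneX
  -- Averaging inside the compact hull avoids having to show that the set of vectors with remainder
  -- in the cone is closed.
  have hhull : ⨍ y in P.Y, κ y ∂μ ∈ convexHull ℝ (κ '' P.Y) := by
    refine (convex_convexHull ℝ _).set_average_mem
      (hY.image hκ).convexHull_of_finiteDimensional.isClosed h0 (measure_ne_top μ _) ?_ hκi
    exact (ae_restrict_mem hY.measurableSet).mono fun y hy =>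
      subset_convexHull ℝ _ ⟨y, hy, rfl⟩
  have hconv : Convex ℝ {v : P.pX.support → ℝ | firstOrderRemainder a (toPoly v) ∈ P.coneX} := by
    intro v hv w hw b c hb hc _
    change firstOrderRemainder a (toPoly (b • v + c • w)) ∈ P.coneX
    rw [map_add, map_add, map_smul, map_smul, map_smul, map_smul]
    exact P.add_mem_coneX (P.smul_mem_coneX hb hv) (P.smul_mem_coneX hc hw)
  have hsub : convexHull ℝ (κ '' P.Y) ⊆
      {v : P.pX.support → ℝ | firstOrderRemainder a (toPoly v) ∈ P.coneX} := by
    refine convexHull_min ?_ hconv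
    rintro _ ⟨y, hy, rfl⟩
    change firstOrderRemainder a (toPoly (κ y)) ∈ P.coneX
    rw [htoPoly]
    exact P.firstOrderRemainder_mem_coneX (hp y hy) (P.totalDegree_pAt_le y) a
  have hav : ∫ y in P.Y, κ y ∂μ = μ.real P.Y • ⨍ y in P.Y, κ y ∂μ := by
    rw [setAverage_eq, smul_smul, mul_inv_cancel₀, one_smul]
    exact (measureReal_ne_zero_iff).2 h0
  rw [hav, map_smul, map_smul]
  exact P.smul_mem_coneX measureReal_nonneg (hsub hhull)

/-- Exactness of the primal problem. -/
theorem primal_exact (hdata : P.SOSConvexData) (hY : IsCompact P.Y) (hA2 : P.A2)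
    (hS : P.S.Nonempty) (hpos : ∀ h ∈ Cy, ∀ y ∈ P.Y, 0 ≤ eval y h)
    (hmem : ∀ h : MvPolynomial (Fin n) ℝ, h.totalDegree ≤ P.dy → (∀ y ∈ P.Y, 0 ≤ eval y h) →
      h ∈ Cy) (hA3 : P.A3) :
    P.rPrimal P.coneX Cy = (P.rStar : EReal) ∧
      ∃ H η, P.PrimalFeasible P.coneX Cy P.rStar H η := by
  obtain ⟨x, hx⟩ := hS
  have hr := rStar_eq_obj hx
  have hgx := hA2.g_pos hx.1
  obtain ⟨hf, hg, hψ, hp⟩ := hdata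
  obtain ⟨μ, η, _, -, hη, hglb⟩ := hA3
  let H := integralFunctional hY μ
  set Λ := P.f - P.rStar • P.g + applyFunctional H P.pY + ∑ j, η j • P.ψ j with hΛ
  have hev : ∀ z, eval z Λ = P.lagrangian z μ η := by
    intro z
    simp only [hΛ, map_add, map_sub, smul_eval, eval_applyFunctional, map_sum, lagrangian]
    congr 2
    change ∫ y in P.Y, eval y (map (eval z) P.pY) ∂μ = _
    simp only [eval_map_eval_pY]
  have hnn : ∀ z, 0 ≤ eval z Λ := fun z => by
    rw [hev]; exact hglb.1 ⟨z, rfl⟩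
  -- At a minimizer `f - r* g` vanishes and the constraint terms are nonpositive.
  have hzero : eval x Λ = 0 := by
    refine le_antisymm ?_ (hnn x)
    rw [hev, lagrangian]
    have h1 : eval x P.f - P.rStar * eval x P.g = 0 := by
      rw [hr, obj, div_mul_cancel₀ _ hgx.ne', sub_self]
    have h2 : ∫ y in P.Y, eval (Sum.elim x y) P.p ∂μ ≤ 0 :=
      setIntegral_nonpos hY.measurableSet hx.1.2
    have h3 : ∑ j, η j * eval x (P.ψ j) ≤ 0 :=
      Finset.sum_nonpos fun j _ => mul_nonpos_of_nonneg_of_nonpos (hη j) (hx.1.1 j)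
    linarith
  -- A negative `r*` reverses the convexity of `-r* g`; by (A2) this can happen only for affine `g`.
  have hgmem : firstOrderRemainder x (-(P.rStar • P.g)) ∈ P.coneX := by
    by_cases h0 : 0 ≤ P.rStar
    · rw [← smul_neg, map_smul]
      refine P.smul_mem_coneX h0 (P.firstOrderRemainder_mem_coneX hg ?_ x)
      rw [totalDegree_neg]
      exact P.totalDegree_g_le
    · rcases hA2 with hA | ⟨hdeg, -⟩
      · refine absurd ?_ h0
        rw [hr]
        exact div_nonneg (hA x hx.1).1 (hA x hx.1).2.le
      · rw [← neg_smul, map_smul]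
        exact P.smul_mem_coneX (by linarith)
          (P.firstOrderRemainder_mem_coneX (sosConvex_of_totalDegree_le_one hdeg)
            P.totalDegree_g_le x)
  have hΛmem : Λ ∈ P.coneX := by
    rw [← firstOrderRemainder_eq_self hnn hzero, hΛ, sub_eq_add_neg, map_add, map_add, map_add,
      map_sum]
    refine P.add_mem_coneX (P.add_mem_coneX (P.add_mem_coneX
      (P.firstOrderRemainder_mem_coneX hf P.totalDegree_f_le x) hgmem)
      (firstOrderRemainder_integral_mem_coneX hp hY μ x)) (P.sum_mem_coneX _ fun j _ => ?_)
    rw [map_smul]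
    exact P.smul_mem_coneX (hη j) (P.firstOrderRemainder_mem_coneX (hψ j) (P.totalDegree_ψ_le j) x)
  have hfeas : P.PrimalFeasible P.coneX Cy P.rStar H η :=
    ⟨hΛmem, fun h hh => setIntegral_nonneg hY.measurableSet (hpos h hh), hη⟩
  refine ⟨?_, H, η, hfeas⟩
  refine IsGreatest.csSup_eq ⟨⟨P.rStar, H, η, hfeas, rfl⟩, ?_⟩
  rintro _ ⟨ρ, H', η', h', rfl⟩
  rw [hr]
  exact EReal.coe_le_coe_iff.2 (h'.le_obj hmem hx.1 hgx)

/-! ### Exactness of the two cones in y. -/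

theorem IsCase1.nonneg_and_mem_coneY1 {i : Fin n} (h : P.IsCase1 i) :
    (∀ h ∈ P.coneY1 i, ∀ y ∈ P.Y, 0 ≤ eval y h) ∧
      ∀ h : MvPolynomial (Fin n) ℝ, h.totalDegree ≤ P.dy → (∀ y ∈ P.Y, 0 ≤ eval y h) →
        h ∈ P.coneY1 i := by
  obtain ⟨hn, hY, -⟩ := h
  constructor
  · rintro _ ⟨θ₀, θ₁, h₀, h₁, -, -, rfl⟩ y hy
    rw [hY] at hy
    obtain ⟨hy1, hy2⟩ : -1 ≤ y i ∧ y i ≤ 1 := hy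
    simp only [map_add, map_mul, map_sub, map_one, map_pow, eval_X]
    exact add_nonneg (h₀.eval_nonneg y) (mul_nonneg (h₁.eval_nonneg y) (by nlinarith))
  · intro h hd hh
    subst hn
    -- Since `d_y ≤ 2⌈d_y/2⌉`, the even-degree representation covers both parities of `d_y`.
    refine exists_isSumSq_of_nonneg_Icc i (hd.trans (by omega)) fun y hy => hh y ?_
    rw [hY]
    exact hy

theorem IsCase2.nonneg_and_mem_coneY2 {φ : MvPolynomial (Fin n) ℝ} (h : P.IsCase2 φ) :
    (∀ h ∈ coneY2 φ, ∀ y ∈ P.Y, 0 ≤ eval y h) ∧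
      ∀ h : MvPolynomial (Fin n) ℝ, h.totalDegree ≤ P.dy → (∀ y ∈ P.Y, 0 ≤ eval y h) →
        h ∈ coneY2 φ := by
  obtain ⟨-, hY, hφ, hpos, hdy, -⟩ := h
  constructor
  · rintro _ ⟨θ, c, hθ, -, hc, rfl⟩ y hy
    rw [hY] at hy
    rw [map_add, smul_eval]
    exact add_nonneg (hθ.eval_nonneg y) (mul_nonneg hc hy)
  · intro h hd hh
    rw [hY] at hh
    exact exists_isSumSq_add_smul_of_nonneg (hd.trans hdy.le) hφ.le hpos hh

end FSIPP

end

theorem mainTheorem4 {m n s : ℕ} (P : FSIPP m n s)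
    (Cy : Set (MvPolynomial (Fin n) ℝ))
    (hcase : (∃ i : Fin n, P.IsCase1 i ∧ Cy = P.coneY1 i) ∨
      (∃ φ : MvPolynomial (Fin n) ℝ, P.IsCase2 φ ∧ Cy = coneY2 φ))
    (hY : IsCompact P.Y) (hS : P.S.Nonempty) (hA2 : P.A2) :
    (P.rDual P.coneX Cy = (P.rStar : EReal) ∧
      (∃ L, P.IsDualMinimizer P.coneX Cy L) ∧
      ∀ L, P.IsDualMinimizer P.coneX Cy L →
        0 < L 1 ∧ (fun i => L (MvPolynomial.X i) / L 1) ∈ P.S) ∧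
    (P.A3 →
      P.rPrimal P.coneX Cy = (P.rStar : EReal) ∧
      ∃ H η, P.PrimalFeasible P.coneX Cy P.rStar H η) := by
  rcases hcase with ⟨i, hi, rfl⟩ | ⟨φ, hφ, rfl⟩
  · obtain ⟨hpos, hmem⟩ := hi.nonneg_and_mem_coneY1
    exact ⟨FSIPP.dual_exact hi.2.2 hA2 hS hpos hmem,
      FSIPP.primal_exact hi.2.2 hY hA2 hS hpos hmem⟩
  · obtain ⟨hpos, hmem⟩ := hφ.nonneg_and_mem_coneY2
    exact ⟨FSIPP.dual_exact hφ.2.2.2.2.2 hA2 hS hpos hmem,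
      FSIPP.primal_exact hφ.2.2.2.2.2 hY hA2 hS hpos hmem⟩
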